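/- Let $T_0$ be a (nondegenerate) triangle in the Euclidean plane with circumcircle $S$ of radius $R$, and let $E$ be its Brocard inellipse, i.e. the ellipse centered at the Brocard midpoint $X_{39}$ (trilinears $s_1(s_2^2+s_3^2)::$, where $s_1,s_2,s_3$ are the sidelengths) that touches each sideline at its intersection with the cevian through the symmedian point $X_6$ (trilinears $s_1:s_2:s_3$). The Brocard porism of $(S,E)$ is the family of all triangles inscribed in $S$ whose three sidelines are tangent to $E$. The Brocard angle $\omega$ of a triangle $P_1P_2P_3$ is the common value of the angles $\angle\Omega P_1P_2=\angle\Omega P_2P_3=\angle\Omega P_3P_1$ for an interior point $\Omega$ (a Brocard point), and $X_{11171}$ denotes the triangle center with trilinear coordinates $2\cos A-\cos(A+2\omega)::$. (i) For every triangle $T$ of the Brocard porism of $(S,E)$, the Brocard angle $\omega$ of $T$ exists, $R(2\cos 2\omega-1)/3\ge 0$, and the locus of the barycenter $X_2$ over the porism is the whole circle centered at the point $X_{11171}$ of $T$ with radius \[\frac{R\,(2\cos 2\omega-1)}{3}.\] (ii) Let $0<b\le a$. There is a Brocard porism with inellipse $E:\ x^2/a^2+y^2/b^2=1$ whose circumcenter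 has nonpositive ordinate, and for every such porism the locus of $X_2$ is the circle with center and radius \[\left(0,\,-\frac{\sqrt{4a^4-5a^2b^2+b^4}}{3b}\right),\qquad \frac{2(a^2-b^2)}{3b},\] that is, the set \[x^2+y^2+\frac{2\sqrt{4a^4-5a^2b^2+b^4}}{3b}\,y+\frac{a^2-b^2}{3}=0.\] In the case of equilateral triangles ($a=b$) the circle degenerates to a point. -/

import Mathlib

open scoped EuclideanGeometry

noncomputable section

namespace BrocardPorism

/-- The Euclidean plane. -/
abbrev Plane : Type := EuclideanSpace ℝ (Fin 2)

/-- A nondegenerate triangle, with vertices `T.points 0`, `T.points 1`, `T.points 2`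
(indices are read modulo 3). -/
abbrev Tri : Type := Affine.Triangle ℝ Plane

/-- The length of the side opposite to the vertex `i`. -/
def sideLength (T : Tri) (i : Fin 3) : ℝ :=
  dist (T.points (i + 1)) (T.points (i + 2))

/-- The interior angle at the vertex `i`. -/
def vertexAngle (T : Tri) (i : Fin 3) : ℝ :=
  ∠ (T.points (i + 1)) (T.points i) (T.points (i + 2))

/-- The line carrying the side opposite to the vertex `i`. -/
def sideLine (T : Tri) (i : Fin 3) : AffineSubspace ℝ Plane :=
  line[ℝ, T.points (i + 1), T.points (i + 2)]

/-- The point with trilinear coordinates `p 0 : p 1 : p 2` with respect to `T`, that is,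
`(∑ i, p i * s i • P i) / (∑ i, p i * s i)` with vertices `P i` and opposite side lengths `s i`. -/
def ofTrilinears (T : Tri) (p : Fin 3 → ℝ) : Plane :=
  (∑ i, p i * sideLength T i)⁻¹ • ∑ i, (p i * sideLength T i) • T.points i

/-- The symmedian point: trilinears `s 0 : s 1 : s 2`. -/
def X6 (T : Tri) : Plane := ofTrilinears T (sideLength T)

/-- The Brocard midpoint: trilinears `s i * (s (i+1) ^ 2 + s (i+2) ^ 2)`. -/
def X39 (T : Tri) : Plane :=
  ofTrilinears T fun i =>
    sideLength T i * (sideLength T (i + 1) ^ 2 + sideLength T (i + 2) ^ 2)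

/-- `ω` is the Brocard angle of `T`: for some interior point `Ω` (a Brocard point), the rays from
each vertex to `Ω` and to the next vertex form the angle `ω`. -/
def IsBrocardAngle (T : Tri) (ω : ℝ) : Prop :=
  ∃ Ω ∈ T.interior, ∀ i : Fin 3, ∠ Ω (T.points i) (T.points (i + 1)) = ω

/-- The triangle center with trilinears `2 cos A - cos (A + 2 ω) ::`, where `ω` is meant to be the
Brocard angle of `T`. -/
def X11171 (T : Tri) (ω : ℝ) : Plane :=
  ofTrilinears T fun i => 2 * Real.cos (vertexAngle T i) - Real.cos (vertexAngle T i + 2 * ω)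

/-- The ellipse `x² / a² + y² / b² = 1`. -/
def stdEllipse (a b : ℝ) : Set Plane := {p | p 0 ^ 2 / a ^ 2 + p 1 ^ 2 / b ^ 2 = 1}

/-- `E` is an ellipse centered at `o`. -/
def IsEllipseAt (E : Set Plane) (o : Plane) : Prop :=
  ∃ a b : ℝ, 0 < b ∧ b ≤ a ∧ ∃ g : Plane ≃ᵃⁱ[ℝ] Plane, g 0 = o ∧ E = g '' stdEllipse a b

/-- `E` is the Brocard inellipse of `T`: the ellipse centered at `X39` that touches each side line
where this line meets the cevian through `X6`. (A line is tangent to an ellipse at `D` iff `D` is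
their only common point.) -/
def IsBrocardInellipse (T : Tri) (E : Set Plane) : Prop :=
  IsEllipseAt E (X39 T) ∧
    ∀ i : Fin 3, ∃ D ∈ line[ℝ, T.points i, X6 T], (sideLine T i : Set Plane) ∩ E = {D}

/-- `S` and `E` are the circumcircle and the Brocard inellipse of some triangle. -/
def IsBrocardPair (S : EuclideanGeometry.Sphere Plane) (E : Set Plane) : Prop :=
  ∃ T : Tri, T.circumsphere = S ∧ IsBrocardInellipse T E

/-- The Poncelet family of the pair `(S, E)`: the triangles inscribed in the circle `S` whose three
side lines are tangent to the ellipse `E`. -/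
def family (S : EuclideanGeometry.Sphere Plane) (E : Set Plane) : Set Tri :=
  {T | T.circumsphere = S ∧ ∀ i : Fin 3, ∃ D, (sideLine T i : Set Plane) ∩ E = {D}}

/-- The locus of the barycenter `X2` over the Poncelet family of `(S, E)`. -/
def locusX2 (S : EuclideanGeometry.Sphere Plane) (E : Set Plane) : Set Plane :=
  (fun T : Tri => T.centroid) '' family S E

end BrocardPorism

end

/-! Let `O` and `R` be the center and radius of `S`, `K` the symmedian point and `s = sin² ω`. The
Brocard midpoint is `s O + (1 - s) K`. The areas that `K` spans with the sides are proportional to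
the squared sides. For chords of the circumcircle, `dual_conic_of_chord` translates the squared form
of this proportionality into tangency to a conic centered at the Brocard midpoint that depends only
on `O`, `R` and `s`. Matching this conic with `E` in the axes of `E` gives `a² = s R²`, `b = 2 s R`
and `O` on the minor axis (`IsBrocardPair.exists_isStdPair`). Read backwards, the same identity
shows that all triangles of the porism share `K` and `ω` (`IsStdPair.X6_of_mem_family`); the signs
lost in squaring are recovered because `K` lies inside `S`.

A power computation (`centroid_dist_sq`) puts the centroid at distance `R |1 - 4 s| / 3` from `O +
(2/3) cos² ω (K - O)`, a point that depends only on the porism. This point is `X11171`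
(`X11171_apply`), and `1 - 4 s = 2 cos 2ω - 1 ≥ 0`.

The circle is covered entirely (`IsStdPair.locusX2_eq`): the projective map of the disk that sends
its center to `K` carries inscribed equilateral triangles to triangles of the porism. As they
rotate, the height of the centroid takes every value between its extremes, and a reflection supplies
both signs of the other coordinate. Isometries reduce (i) to standard position; an isosceles
triangle gives the existence in (ii). -/

namespace BrocardPorism

/-! ### Coordinates and tangency to a standard ellipse. -/

/-- Twice the signed area of the triangle `X P Q`. -/
def crossAt (X P Q : Plane) : ℝ :=
  (P 0 - X 0) * (Q 1 - X 1) - (P 1 - X 1) * (Q 0 - X 0)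

/-- Twice the signed area of `T`. -/
def doubleArea (T : Tri) : ℝ := crossAt (T.points 0) (T.points 1) (T.points 2)

theorem plane_ext {P Q : Plane} (h0 : P 0 = Q 0) (h1 : P 1 = Q 1) : P = Q := by
  ext i
  fin_cases i
  · exact h0
  · exact h1

theorem dist_sq_eq (P Q : Plane) : dist P Q ^ 2 = (P 0 - Q 0) ^ 2 + (P 1 - Q 1) ^ 2 := by
  rw [EuclideanSpace.dist_eq, Real.sq_sqrt (by positivity)]
  simp [Fin.sum_univ_two, Real.dist_eq, sq_abs]

theorem mem_sphere_iff_sq {C P : Plane} {r : ℝ} (hr : 0 ≤ r) :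
    P ∈ Metric.sphere C r ↔ (P 0 - C 0) ^ 2 + (P 1 - C 1) ^ 2 = r ^ 2 := by
  rw [Metric.mem_sphere, ← dist_sq_eq]
  exact ⟨fun h => by rw [h], fun h => (sq_eq_sq₀ dist_nonneg hr).1 h⟩

theorem mem_line_iff {P Q X : Plane} :
    X ∈ line[ℝ, P, Q] ↔
      ∃ t : ℝ, X 0 = P 0 + t * (Q 0 - P 0) ∧ X 1 = P 1 + t * (Q 1 - P 1) := by
  rw [mem_affineSpan_pair_iff_exists_lineMap_eq]
  constructor
  · rintro ⟨t, rfl⟩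
    refine ⟨t, ?_, ?_⟩ <;> simp [AffineMap.lineMap_apply] <;> ring
  · rintro ⟨t, h0, h1⟩
    refine ⟨t, plane_ext ?_ ?_⟩ <;> simp [AffineMap.lineMap_apply, h0, h1] <;> ring

/-- A line is tangent to an ellipse iff its coefficients lie on the dual conic. -/
theorem line_inter_stdEllipse_eq_singleton_iff {a b : ℝ} (ha : 0 < a) (hb : 0 < b) {P Q : Plane}
    (hPQ : P ≠ Q) :
    (∃ D, (line[ℝ, P, Q] : Set Plane) ∩ stdEllipse a b = {D}) ↔
      a ^ 2 * (P 1 - Q 1) ^ 2 + b ^ 2 * (P 0 - Q 0) ^ 2 = (P 0 * Q 1 - P 1 * Q 0) ^ 2 := by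
  -- At the point `P + t (Q - P)` the ellipse equation, cleared of denominators, is `α t² + 2 β t +
  -- γ = 0`; tangency means `β² = α γ`.
  obtain ⟨α, hα⟩ : ∃ α, α = b ^ 2 * (Q 0 - P 0) ^ 2 + a ^ 2 * (Q 1 - P 1) ^ 2 := ⟨_, rfl⟩
  obtain ⟨β, hβ⟩ : ∃ β, β = b ^ 2 * P 0 * (Q 0 - P 0) + a ^ 2 * P 1 * (Q 1 - P 1) := ⟨_, rfl⟩
  obtain ⟨γ, hγ⟩ : ∃ γ, γ = b ^ 2 * P 0 ^ 2 + a ^ 2 * P 1 ^ 2 - a ^ 2 * b ^ 2 := ⟨_, rfl⟩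
  have hαpos : 0 < α := by
    by_contra hcon
    have h0 : b ^ 2 * (Q 0 - P 0) ^ 2 = 0 := by
      nlinarith [show 0 ≤ b ^ 2 * (Q 0 - P 0) ^ 2 by positivity,
        show 0 ≤ a ^ 2 * (Q 1 - P 1) ^ 2 by positivity]
    have h1 : a ^ 2 * (Q 1 - P 1) ^ 2 = 0 := by
      nlinarith [show 0 ≤ b ^ 2 * (Q 0 - P 0) ^ 2 by positivity,
        show 0 ≤ a ^ 2 * (Q 1 - P 1) ^ 2 by positivity]
    have h0' : Q 0 - P 0 = 0 := by simpa [hb.ne'] using h0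
    have h1' : Q 1 - P 1 = 0 := by simpa [ha.ne'] using h1
    exact hPQ (plane_ext (by linarith) (by linarith))
  have hmem : ∀ X : Plane, ∀ t : ℝ, X 0 = P 0 + t * (Q 0 - P 0) → X 1 = P 1 + t * (Q 1 - P 1) →
      (X ∈ stdEllipse a b ↔ α * t ^ 2 + 2 * β * t + γ = 0) := by
    intro X t h0 h1
    have hdef : X ∈ stdEllipse a b ↔ X 0 ^ 2 / a ^ 2 + X 1 ^ 2 / b ^ 2 = 1 := Iff.rfl
    have ha' := ha.ne'
    have hb' := hb.ne'
    rw [hdef, h0, h1, hα, hβ, hγ]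
    field_simp
    constructor <;> intro h <;> linear_combination h
  have hdisc : a ^ 2 * b ^ 2 * (a ^ 2 * (P 1 - Q 1) ^ 2 + b ^ 2 * (P 0 - Q 0) ^ 2
      - (P 0 * Q 1 - P 1 * Q 0) ^ 2) = β ^ 2 - α * γ := by
    rw [hα, hβ, hγ]; ring
  have hdisc' : (a ^ 2 * (P 1 - Q 1) ^ 2 + b ^ 2 * (P 0 - Q 0) ^ 2 =
      (P 0 * Q 1 - P 1 * Q 0) ^ 2) ↔ β ^ 2 - α * γ = 0 := by
    rw [← hdisc, mul_eq_zero, sub_eq_zero]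
    constructor
    · exact Or.inr
    · rintro (h | h)
      · exact absurd h (by positivity)
      · exact h
  rw [hdisc']
  constructor
  · rintro ⟨D, hD⟩
    obtain ⟨hDl, hDe⟩ : D ∈ (line[ℝ, P, Q] : Set Plane) ∩ stdEllipse a b := by rw [hD]; rfl
    obtain ⟨t, h0, h1⟩ := mem_line_iff.1 hDl
    have ht := (hmem D t h0 h1).1 hDe
    -- By Vieta, `-2 β / α - t` is the other root, so `X` is the second intersection point and must
    -- coincide with `D`.
    let X : Plane := !₂[P 0 + (-2 * β / α - t) * (Q 0 - P 0), P 1 + (-2 * β / α - t) * (Q 1 - P 1)]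
    have hX0 : X 0 = P 0 + (-2 * β / α - t) * (Q 0 - P 0) := rfl
    have hX1 : X 1 = P 1 + (-2 * β / α - t) * (Q 1 - P 1) := rfl
    have hXe : X ∈ stdEllipse a b := by
      rw [hmem X _ hX0 hX1]
      have : α ≠ 0 := hαpos.ne'
      field_simp
      linear_combination α * ht
    have hXD : X = D := by
      have : X ∈ (line[ℝ, P, Q] : Set Plane) ∩ stdEllipse a b :=
        ⟨mem_line_iff.2 ⟨_, hX0, hX1⟩, hXe⟩
      rw [hD] at this
      exact this
    have htt : -2 * β / α - t = t := by
      by_contra hne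
      have e0 : (-2 * β / α - t - t) * (Q 0 - P 0) = 0 := by
        have := congrArg (fun Z : Plane => Z 0) hXD
        simp only [hX0, h0] at this
        linear_combination this
      have e1 : (-2 * β / α - t - t) * (Q 1 - P 1) = 0 := by
        have := congrArg (fun Z : Plane => Z 1) hXD
        simp only [hX1, h1] at this
        linear_combination this
      have hne' : -2 * β / α - t - t ≠ 0 := sub_ne_zero.2 hne
      have e0' := (mul_eq_zero.1 e0).resolve_left hne'
      have e1' := (mul_eq_zero.1 e1).resolve_left hne'
      exact hPQ (plane_ext (by linarith) (by linarith))
    have hβt : β = -(α * t) := by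
      field_simp at htt
      linear_combination (-1 / 2) * htt
    rw [hβt] at ht ⊢
    linear_combination -α * ht
  · intro h
    let X : Plane := !₂[P 0 + (-β / α) * (Q 0 - P 0), P 1 + (-β / α) * (Q 1 - P 1)]
    have hX0 : X 0 = P 0 + (-β / α) * (Q 0 - P 0) := rfl
    have hX1 : X 1 = P 1 + (-β / α) * (Q 1 - P 1) := rfl
    have hα0 : α ≠ 0 := hαpos.ne'
    refine ⟨X, Set.eq_singleton_iff_unique_mem.2 ⟨⟨mem_line_iff.2 ⟨_, hX0, hX1⟩, ?_⟩, ?_⟩⟩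
    · rw [hmem X _ hX0 hX1]
      field_simp
      linear_combination -h
    · rintro Y ⟨hYl, hYe⟩
      obtain ⟨t, h0, h1⟩ := mem_line_iff.1 hYl
      have ht := (hmem Y t h0 h1).1 hYe
      have hsq : (α * t + β) ^ 2 = 0 := by linear_combination α * ht + h
      have ht' : t = -β / α := by
        have := pow_eq_zero_iff (two_ne_zero) |>.1 hsq
        field_simp
        linear_combination this
      apply plane_ext
      · rw [h0, hX0, ht']
      · rw [h1, hX1, ht']

/-! ### Area, circumcenter, `X6` and `X39` in barycentric coordinates. -/

theorem doubleArea_ne_zero (T : Tri) : doubleArea T ≠ 0 := by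
  intro h
  have hcol : Collinear ℝ (Set.range T.points) := by
    have h01 : T.points 0 ≠ T.points 1 := fun h => by
      simpa using T.independent.injective h
    have h2 : T.points 2 ∈ line[ℝ, T.points 0, T.points 1] := by
      rw [mem_line_iff]
      simp only [doubleArea, crossAt] at h
      by_cases hx : T.points 1 0 - T.points 0 0 = 0
      · have hy : T.points 1 1 - T.points 0 1 ≠ 0 := fun hy =>
          h01 (plane_ext (by linarith) (by linarith))
        refine ⟨(T.points 2 1 - T.points 0 1) / (T.points 1 1 - T.points 0 1), ?_, ?_⟩
        · rw [hx] at h ⊢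
          have : T.points 2 0 - T.points 0 0 = 0 := by
            have h3 : (T.points 1 1 - T.points 0 1) * (T.points 2 0 - T.points 0 0) = 0 := by
              linear_combination -h
            exact (mul_eq_zero.1 h3).resolve_left hy
          linarith
        · field_simp
          ring
      · refine ⟨(T.points 2 0 - T.points 0 0) / (T.points 1 0 - T.points 0 0), ?_, ?_⟩
        · field_simp
          ring
        · field_simp
          linear_combination h
    have hr : Set.range T.points = {T.points 2, T.points 0, T.points 1} := by
      ext x
      simp only [Set.mem_range, Fin.exists_fin_succ, Set.mem_insert_iff, Set.mem_singleton_iff]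
      constructor
      · rintro (h | h | h | ⟨i, _⟩)
        · exact Or.inr (Or.inl h.symm)
        · exact Or.inr (Or.inr h.symm)
        · exact Or.inl h.symm
        · exact i.elim0
      · rintro (h | h | h)
        · exact Or.inr (Or.inr (Or.inl h.symm))
        · exact Or.inl h.symm
        · exact Or.inr (Or.inl h.symm)
    rw [hr]
    exact collinear_insert_of_mem_affineSpan_pair h2
  exact (affineIndependent_iff_not_collinear.1 T.independent) hcol

theorem affineSpan_range_points (T : Tri) : affineSpan ℝ (Set.range T.points) = ⊤ := by
  apply T.independent.affineSpan_eq_top_iff_card_eq_finrank_add_one.2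
  simp

theorem circumsphere_eq_iff (T : Tri) (S : EuclideanGeometry.Sphere Plane) :
    T.circumsphere = S ↔ ∀ i, dist (T.points i) S.center = S.radius := by
  constructor
  · rintro rfl i
    exact T.mem_circumsphere i
  · intro h
    refine (T.circumsphere_unique_dist_eq.2 S ⟨?_, ?_⟩).symm
    · rw [affineSpan_range_points]
      trivial
    · rintro _ ⟨i, rfl⟩
      exact h i

theorem ofTrilinears_apply (T : Tri) (p : Fin 3 → ℝ) (j : Fin 2) :
    ofTrilinears T p j =
      (p 0 * sideLength T 0 + p 1 * sideLength T 1 + p 2 * sideLength T 2)⁻¹ *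
        (p 0 * sideLength T 0 * T.points 0 j + p 1 * sideLength T 1 * T.points 1 j
          + p 2 * sideLength T 2 * T.points 2 j) := by
  simp [ofTrilinears, Fin.sum_univ_three, mul_add]

theorem centroid_apply (T : Tri) (j : Fin 2) :
    T.centroid j = (T.points 0 j + T.points 1 j + T.points 2 j) / 3 := by
  have := T.centroid_eq_smul_sum_vsub_vadd 0
  rw [this]
  simp [Fin.sum_univ_three]
  ring

/-- The sum of the squared side lengths. -/
noncomputable def sideSqSum (T : Tri) : ℝ := sideLength T 0 ^ 2 + sideLength T 1 ^ 2 + sideLength T 2 ^ 2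

/-- The sum of the products of two squared side lengths. -/
noncomputable def sideSqPairSum (T : Tri) : ℝ :=
  sideLength T 0 ^ 2 * sideLength T 1 ^ 2 + sideLength T 1 ^ 2 * sideLength T 2 ^ 2
    + sideLength T 2 ^ 2 * sideLength T 0 ^ 2

theorem sideLength_zero_sq (T : Tri) : sideLength T 0 ^ 2 =
    (T.points 1 0 - T.points 2 0) ^ 2 + (T.points 1 1 - T.points 2 1) ^ 2 := dist_sq_eq _ _

theorem sideLength_one_sq (T : Tri) : sideLength T 1 ^ 2 =
    (T.points 2 0 - T.points 0 0) ^ 2 + (T.points 2 1 - T.points 0 1) ^ 2 := dist_sq_eq _ _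

theorem sideLength_two_sq (T : Tri) : sideLength T 2 ^ 2 =
    (T.points 0 0 - T.points 1 0) ^ 2 + (T.points 0 1 - T.points 1 1) ^ 2 := dist_sq_eq _ _

theorem sideLength_pos (T : Tri) (i : Fin 3) : 0 < sideLength T i := by
  apply dist_pos.2
  intro h
  have := T.independent.injective h
  revert this
  fin_cases i <;> decide

theorem sideSqSum_pos (T : Tri) : 0 < sideSqSum T := by
  have h0 := sideLength_pos T 0
  have h1 := sideLength_pos T 1
  have h2 := sideLength_pos T 2
  unfold sideSqSum
  positivity

theorem sideSqPairSum_pos (T : Tri) : 0 < sideSqPairSum T := by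
  have h0 := sideLength_pos T 0
  have h1 := sideLength_pos T 1
  have h2 := sideLength_pos T 2
  unfold sideSqPairSum
  positivity

/-- Heron's formula. -/
theorem four_mul_doubleArea_sq (T : Tri) :
    4 * doubleArea T ^ 2 = 4 * sideSqPairSum T - sideSqSum T ^ 2 := by
  unfold sideSqPairSum sideSqSum doubleArea crossAt
  rw [sideLength_zero_sq, sideLength_one_sq, sideLength_two_sq]
  ring

theorem circumsphere_sq {T : Tri} {S : EuclideanGeometry.Sphere Plane} (h : T.circumsphere = S)
    (i : Fin 3) :
    (T.points i 0 - S.center 0) ^ 2 + (T.points i 1 - S.center 1) ^ 2 = S.radius ^ 2 := by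
  rw [← dist_sq_eq, (circumsphere_eq_iff T S).1 h i]

theorem doubleArea_mul_center_zero {T : Tri} {S : EuclideanGeometry.Sphere Plane}
    (h : T.circumsphere = S) :
    2 * doubleArea T * (S.center 0 - T.points 0 0) =
      sideLength T 2 ^ 2 * (T.points 2 1 - T.points 0 1)
        - sideLength T 1 ^ 2 * (T.points 1 1 - T.points 0 1) := by
  have h0 := circumsphere_sq h 0
  have h1 := circumsphere_sq h 1
  have h2 := circumsphere_sq h 2
  unfold doubleArea crossAt
  rw [sideLength_one_sq, sideLength_two_sq]
  linear_combination (T.points 2 1 - T.points 0 1) * (h0 - h1)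
    - (T.points 1 1 - T.points 0 1) * (h0 - h2)

theorem doubleArea_mul_center_one {T : Tri} {S : EuclideanGeometry.Sphere Plane}
    (h : T.circumsphere = S) :
    2 * doubleArea T * (S.center 1 - T.points 0 1) =
      sideLength T 1 ^ 2 * (T.points 1 0 - T.points 0 0)
        - sideLength T 2 ^ 2 * (T.points 2 0 - T.points 0 0) := by
  have h0 := circumsphere_sq h 0
  have h1 := circumsphere_sq h 1
  have h2 := circumsphere_sq h 2
  unfold doubleArea crossAt
  rw [sideLength_one_sq, sideLength_two_sq]
  linear_combination (T.points 1 0 - T.points 0 0) * (h0 - h2)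
    - (T.points 2 0 - T.points 0 0) * (h0 - h1)

/-- The square of the classical formula: the product of the sides is `4 R` times the area. -/
theorem sideLength_sq_prod {T : Tri} {S : EuclideanGeometry.Sphere Plane}
    (h : T.circumsphere = S) :
    sideLength T 0 ^ 2 * sideLength T 1 ^ 2 * sideLength T 2 ^ 2 =
      4 * doubleArea T ^ 2 * S.radius ^ 2 := by
  have e0 := doubleArea_mul_center_zero h
  have e1 := doubleArea_mul_center_one h
  have h0 := circumsphere_sq h 0
  have key : 4 * doubleArea T ^ 2 * S.radius ^ 2 =
      (2 * doubleArea T * (S.center 0 - T.points 0 0)) ^ 2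
        + (2 * doubleArea T * (S.center 1 - T.points 0 1)) ^ 2 := by
    rw [← h0]; ring
  rw [key, e0, e1, sideLength_zero_sq, sideLength_one_sq, sideLength_two_sq]
  ring

/-- For squared sides `l` with sum `σ`, the circumcenter has barycentric weights `l (σ - 2 l)`,
whose sum is sixteen times the squared area. -/
theorem doubleArea_sq_mul_center {T : Tri} {S : EuclideanGeometry.Sphere Plane}
    (h : T.circumsphere = S) (j : Fin 2) :
    4 * doubleArea T ^ 2 * S.center j =
      sideLength T 0 ^ 2 * (sideSqSum T - 2 * sideLength T 0 ^ 2) * T.points 0 j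
        + sideLength T 1 ^ 2 * (sideSqSum T - 2 * sideLength T 1 ^ 2) * T.points 1 j
        + sideLength T 2 ^ 2 * (sideSqSum T - 2 * sideLength T 2 ^ 2) * T.points 2 j := by
  have e0 := doubleArea_mul_center_zero h
  have e1 := doubleArea_mul_center_one h
  unfold doubleArea crossAt sideSqSum at *
  rw [sideLength_zero_sq, sideLength_one_sq, sideLength_two_sq]
  rw [sideLength_one_sq, sideLength_two_sq] at e0 e1
  fin_cases j
  · simp only [Fin.zero_eta]
    linear_combination 2 * ((T.points 1 0 - T.points 0 0) * (T.points 2 1 - T.points 0 1)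
      - (T.points 1 1 - T.points 0 1) * (T.points 2 0 - T.points 0 0)) * e0
  · simp only [Fin.mk_one]
    linear_combination 2 * ((T.points 1 0 - T.points 0 0) * (T.points 2 1 - T.points 0 1)
      - (T.points 1 1 - T.points 0 1) * (T.points 2 0 - T.points 0 0)) * e1

theorem sideSqSum_mul_X6 (T : Tri) (j : Fin 2) :
    sideSqSum T * X6 T j = sideLength T 0 ^ 2 * T.points 0 j + sideLength T 1 ^ 2 * T.points 1 j
      + sideLength T 2 ^ 2 * T.points 2 j := by
  have h := (sideSqSum_pos T).ne'
  rw [X6, ofTrilinears_apply]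
  simp only [← pow_two]
  rw [← sideSqSum, mul_inv_cancel_left₀ h]

theorem sideSqPairSum_mul_X39 (T : Tri) (j : Fin 2) :
    2 * sideSqPairSum T * X39 T j =
      sideLength T 0 ^ 2 * (sideSqSum T - sideLength T 0 ^ 2) * T.points 0 j
        + sideLength T 1 ^ 2 * (sideSqSum T - sideLength T 1 ^ 2) * T.points 1 j
        + sideLength T 2 ^ 2 * (sideSqSum T - sideLength T 2 ^ 2) * T.points 2 j := by
  have h := (sideSqPairSum_pos T).ne'
  have e1 : (1 : Fin 3) + 1 = 2 := rfl
  have e2 : (1 : Fin 3) + 2 = 0 := rfl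
  have e3 : (2 : Fin 3) + 1 = 0 := rfl
  have e4 : (2 : Fin 3) + 2 = 1 := rfl
  rw [X39, ofTrilinears_apply]
  simp only [zero_add, e1, e2, e3, e4]
  have hs : sideLength T 0 * (sideLength T 1 ^ 2 + sideLength T 2 ^ 2) * sideLength T 0
      + sideLength T 1 * (sideLength T 2 ^ 2 + sideLength T 0 ^ 2) * sideLength T 1
      + sideLength T 2 * (sideLength T 0 ^ 2 + sideLength T 1 ^ 2) * sideLength T 2
      = 2 * sideSqPairSum T := by
    unfold sideSqPairSum; ring
  rw [hs, mul_inv_cancel_left₀ (by simpa using h)]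
  unfold sideSqSum
  ring

/-- The Brocard midpoint divides the segment from the circumcenter to the symmedian point. -/
theorem sideSqPairSum_mul_X39_eq {T : Tri} {S : EuclideanGeometry.Sphere Plane}
    (h : T.circumsphere = S) (j : Fin 2) :
    4 * sideSqPairSum T * X39 T j =
      4 * doubleArea T ^ 2 * S.center j + sideSqSum T ^ 2 * X6 T j := by
  have e1 := sideSqPairSum_mul_X39 T j
  have e2 := doubleArea_sq_mul_center h j
  have e3 := sideSqSum_mul_X6 T j
  -- For each squared side `l`, `2 l (σ - l) = l (σ - 2 l) + σ l`: a weight of the Brocard midpoint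
  -- splits into one of the circumcenter and one of the symmedian point.
  linear_combination 2 * e1 - e2 - sideSqSum T * e3

/-! ### Powers with respect to the circumcircle and the circle of the centroid. -/

/-- The power, with respect to the circle of radius `R` about the origin, of a point given by
barycentric weights with respect to three points of this circle. -/
theorem power_of_weights {R u0 v0 u1 v1 u2 v2 : ℝ} (h0 : u0 ^ 2 + v0 ^ 2 = R ^ 2)
    (h1 : u1 ^ 2 + v1 ^ 2 = R ^ 2) (h2 : u2 ^ 2 + v2 ^ 2 = R ^ 2) (n0 n1 n2 : ℝ) :
    (n0 + n1 + n2) ^ 2 * R ^ 2 - (n0 * u0 + n1 * u1 + n2 * u2) ^ 2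
        - (n0 * v0 + n1 * v1 + n2 * v2) ^ 2 =
      n1 * n2 * ((u1 - u2) ^ 2 + (v1 - v2) ^ 2) + n2 * n0 * ((u2 - u0) ^ 2 + (v2 - v0) ^ 2)
        + n0 * n1 * ((u0 - u1) ^ 2 + (v0 - v1) ^ 2) := by
  -- Substituting `2 p·q = |p|² + |q|² - |p - q|²` in the squared norm of the weighted sum, the
  -- terms `nᵢ |pᵢ|²` acquire the common factor `n0 + n1 + n2`.
  linear_combination -(n0 + n1 + n2) * (n0 * h0 + n1 * h1 + n2 * h2)

theorem power_of_weights_triangle {T : Tri} {S : EuclideanGeometry.Sphere Plane}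
    (h : T.circumsphere = S) {n0 n1 n2 m : ℝ} {X : Plane} (hm : n0 + n1 + n2 = m)
    (hX : ∀ j, m * X j = n0 * T.points 0 j + n1 * T.points 1 j + n2 * T.points 2 j) :
    m ^ 2 * (S.radius ^ 2 - (X 0 - S.center 0) ^ 2 - (X 1 - S.center 1) ^ 2) =
      n1 * n2 * sideLength T 0 ^ 2 + n2 * n0 * sideLength T 1 ^ 2
        + n0 * n1 * sideLength T 2 ^ 2 := by
  have key := power_of_weights (circumsphere_sq h 0) (circumsphere_sq h 1) (circumsphere_sq h 2)
    n0 n1 n2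
  have e0 : m * (X 0 - S.center 0) = n0 * (T.points 0 0 - S.center 0)
      + n1 * (T.points 1 0 - S.center 0) + n2 * (T.points 2 0 - S.center 0) := by
    linear_combination hX 0 + S.center 0 * hm
  have e1 : m * (X 1 - S.center 1) = n0 * (T.points 0 1 - S.center 1)
      + n1 * (T.points 1 1 - S.center 1) + n2 * (T.points 2 1 - S.center 1) := by
    linear_combination hX 1 + S.center 1 * hm
  rw [← e0, ← e1, hm] at key
  rw [sideLength_zero_sq, sideLength_one_sq, sideLength_two_sq]
  linear_combination key

/-- With the squared sides as weights, the three products in the power formula are all equal to the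
squared product of the sides. This fixes the distance from the circumcenter to the symmedian point
in terms of the radius and the Brocard angle. -/
theorem power_X6 {T : Tri} {S : EuclideanGeometry.Sphere Plane} (h : T.circumsphere = S) :
    sideSqSum T ^ 2 * (S.radius ^ 2 - (X6 T 0 - S.center 0) ^ 2 - (X6 T 1 - S.center 1) ^ 2) =
      12 * doubleArea T ^ 2 * S.radius ^ 2 := by
  have := power_of_weights_triangle h (X := X6 T) (m := sideSqSum T) rfl (sideSqSum_mul_X6 T)
  rw [this]
  linear_combination 3 * sideLength_sq_prod h

theorem radius_pos {T : Tri} {S : EuclideanGeometry.Sphere Plane} (h : T.circumsphere = S) :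
    0 < S.radius := by
  have h0 := sideLength_pos T 0
  have h1 := sideLength_pos T 1
  have h2 := sideLength_pos T 2
  have hn : 0 ≤ S.radius := by
    rw [← (circumsphere_eq_iff T S).1 h 0]
    exact dist_nonneg
  refine lt_of_le_of_ne hn fun hz => ?_
  have := sideLength_sq_prod h
  rw [← hz] at this
  have hp : 0 < sideLength T 0 ^ 2 * sideLength T 1 ^ 2 * sideLength T 2 ^ 2 := by positivity
  rw [this] at hp
  simp at hp

/-- The centroid of an inscribed triangle lies on a circle that depends only on the circumcircle,
the symmedian point and the Brocard angle. -/
theorem centroid_dist_sq {T : Tri} {S : EuclideanGeometry.Sphere Plane} (h : T.circumsphere = S)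
    {s : ℝ} (hs : sideSqSum T ^ 2 = 4 * (1 - s) * sideSqPairSum T) :
    (T.centroid 0 - (S.center 0 + 2 / 3 * (1 - s) * (X6 T 0 - S.center 0))) ^ 2
      + (T.centroid 1 - (S.center 1 + 2 / 3 * (1 - s) * (X6 T 1 - S.center 1))) ^ 2 =
    (S.radius * (1 - 4 * s) / 3) ^ 2 := by
  have hσ := (sideSqSum_pos T).ne'
  have hq := (sideSqPairSum_pos T).ne'
  -- With this `l`, the vector from the proposed center to the centroid has weights `1/3 - l sᵢ²` on
  -- the vectors from the circumcenter to the vertices.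
  obtain ⟨l, hl⟩ : ∃ l, l = 2 / 3 * (1 - s) / sideSqSum T := ⟨_, rfl⟩
  have hlσ : l * sideSqSum T = 2 / 3 * (1 - s) := by rw [hl]; field_simp
  have hc : ∀ j, T.centroid j - (S.center j + 2 / 3 * (1 - s) * (X6 T j - S.center j)) =
      (1 / 3 - l * sideLength T 0 ^ 2) * (T.points 0 j - S.center j)
      + (1 / 3 - l * sideLength T 1 ^ 2) * (T.points 1 j - S.center j)
      + (1 / 3 - l * sideLength T 2 ^ 2) * (T.points 2 j - S.center j) := by
    intro j
    have h3 := sideSqSum_mul_X6 T j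
    rw [centroid_apply, ← hlσ]
    have : l * sideSqSum T * (X6 T j - S.center j) =
      l * (sideLength T 0 ^ 2 * T.points 0 j + sideLength T 1 ^ 2 * T.points 1 j
      + sideLength T 2 ^ 2 * T.points 2 j) - l * sideSqSum T * S.center j := by
      linear_combination l * h3
    rw [this]
    unfold sideSqSum
    ring
  rw [hc 0, hc 1]
  have key := power_of_weights (circumsphere_sq h 0) (circumsphere_sq h 1) (circumsphere_sq h 2)
    (1 / 3 - l * sideLength T 0 ^ 2) (1 / 3 - l * sideLength T 1 ^ 2)
    (1 / 3 - l * sideLength T 2 ^ 2)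
  have hp := sideLength_sq_prod h
  have hher := four_mul_doubleArea_sq T
  have hsum : 1 / 3 - l * sideLength T 0 ^ 2 + (1 / 3 - l * sideLength T 1 ^ 2)
      + (1 / 3 - l * sideLength T 2 ^ 2) = 1 - 2 / 3 * (1 - s) := by
    rw [← hlσ]; unfold sideSqSum; ring
  rw [hsum] at key
  simp only [sub_sub_sub_cancel_right] at key
  rw [← sideLength_zero_sq, ← sideLength_one_sq, ← sideLength_two_sq] at key
  have hδ : doubleArea T ^ 2 = s * sideSqPairSum T := by linear_combination hher / 4 - hs / 4
  have hlq : l * sideSqPairSum T = sideSqSum T / 6 := by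
    rw [hl]; field_simp; linear_combination -3 * hs
  have hl2 : l ^ 2 * (4 * doubleArea T ^ 2) = 4 / 9 * (1 - s) * s := by
    have : l ^ 2 * (4 * doubleArea T ^ 2) = 4 * s * l * (l * sideSqPairSum T) := by
      rw [hδ]; ring
    rw [this, hlq]
    linear_combination 2 / 3 * s * hlσ
  have hrhs : (1 / 3 - l * sideLength T 1 ^ 2) * (1 / 3 - l * sideLength T 2 ^ 2)
        * sideLength T 0 ^ 2
      + (1 / 3 - l * sideLength T 2 ^ 2) * (1 / 3 - l * sideLength T 0 ^ 2) * sideLength T 1 ^ 2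
      + (1 / 3 - l * sideLength T 0 ^ 2) * (1 / 3 - l * sideLength T 1 ^ 2) * sideLength T 2 ^ 2
      = 4 / 3 * (1 - s) * s * S.radius ^ 2 := by
    have : (1 / 3 - l * sideLength T 1 ^ 2) * (1 / 3 - l * sideLength T 2 ^ 2)
        * sideLength T 0 ^ 2
      + (1 / 3 - l * sideLength T 2 ^ 2) * (1 / 3 - l * sideLength T 0 ^ 2) * sideLength T 1 ^ 2
      + (1 / 3 - l * sideLength T 0 ^ 2) * (1 / 3 - l * sideLength T 1 ^ 2) * sideLength T 2 ^ 2
      = sideSqSum T / 9 - 2 / 3 * (l * sideSqPairSum T) + 3 * l ^ 2 *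
        (sideLength T 0 ^ 2 * sideLength T 1 ^ 2 * sideLength T 2 ^ 2) := by
      unfold sideSqSum sideSqPairSum; ring
    -- The factor `2/3 * (1 - s)` is chosen for this moment: `l * sideSqPairSum T = sideSqSum T / 6`
    -- cancels the first two terms, and the third depends only on `s` and the radius. The final
    -- identity is `(1 + 2 s)² - 12 s (1 - s) = (1 - 4 s)²`.
    rw [this, hlq, hp]
    linear_combination 3 * S.radius ^ 2 * hl2
  rw [hrhs] at key
  linear_combination -key

/-! ### The normal form of a Brocard pair. -/

theorem map_neg_add_map {o : Plane} (g : Plane ≃ᵃⁱ[ℝ] Plane) (hg : g 0 = o) (q : Plane) :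
    g (-q) = (2 : ℝ) • o - g q := by
  have h1 := g.map_vadd 0 q
  have h2 := g.map_vadd 0 (-q)
  simp only [vadd_eq_add, add_zero, hg, map_neg] at h1 h2
  rw [h1, h2, two_smul]
  abel

/-- The center is unique: the ellipse is symmetric about `o`, and the reflections of its four axis
endpoints must stay in the box `|x| ≤ a`, `|y| ≤ b`. -/
theorem eq_zero_of_isEllipseAt_stdEllipse {a b : ℝ} (ha : 0 < a) (hb : 0 < b) {o : Plane}
    (h : IsEllipseAt (stdEllipse a b) o) : o = 0 := by
  obtain ⟨a', b', -, -, g, hg, hE⟩ := h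
  have hdef : ∀ (c d : ℝ) (p : Plane), p ∈ stdEllipse c d ↔
      p 0 ^ 2 / c ^ 2 + p 1 ^ 2 / d ^ 2 = 1 := fun _ _ _ => Iff.rfl
  have hrefl : ∀ p ∈ stdEllipse a b, (2 : ℝ) • o - p ∈ stdEllipse a b := by
    intro p hp
    rw [hE] at hp ⊢
    obtain ⟨q, hq, rfl⟩ := hp
    refine ⟨-q, ?_, map_neg_add_map g hg q⟩
    rw [hdef] at hq ⊢
    simpa using hq
  have hbd0 : ∀ p ∈ stdEllipse a b, p 0 ^ 2 ≤ a ^ 2 := by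
    intro p hp
    rw [hdef] at hp
    have h2 : 0 ≤ p 1 ^ 2 / b ^ 2 := by positivity
    have h1 : p 0 ^ 2 / a ^ 2 ≤ 1 := by linarith
    rwa [div_le_one (by positivity)] at h1
  have hbd1 : ∀ p ∈ stdEllipse a b, p 1 ^ 2 ≤ b ^ 2 := by
    intro p hp
    rw [hdef] at hp
    have h2 : 0 ≤ p 0 ^ 2 / a ^ 2 := by positivity
    have h1 : p 1 ^ 2 / b ^ 2 ≤ 1 := by linarith
    rwa [div_le_one (by positivity)] at h1
  have ha' := ha.ne'
  have hb' := hb.ne'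
  have m1 : (!₂[a, 0] : Plane) ∈ stdEllipse a b := by rw [hdef]; simp [ha']
  have m2 : (!₂[-a, 0] : Plane) ∈ stdEllipse a b := by rw [hdef]; simp [ha']
  have m3 : (!₂[0, b] : Plane) ∈ stdEllipse a b := by rw [hdef]; simp [hb']
  have m4 : (!₂[0, -b] : Plane) ∈ stdEllipse a b := by rw [hdef]; simp [hb']
  have i1 := abs_le_of_sq_le_sq' (hbd0 _ (hrefl _ m1)) ha.le
  have i2 := abs_le_of_sq_le_sq' (hbd0 _ (hrefl _ m2)) ha.le
  have i3 := abs_le_of_sq_le_sq' (hbd1 _ (hrefl _ m3)) hb.le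
  have i4 := abs_le_of_sq_le_sq' (hbd1 _ (hrefl _ m4)) hb.le
  simp at i1 i2 i3 i4
  apply plane_ext <;> simp <;> linarith

/-- The squared chord length of a circle in terms of the distance of the chord from the center. -/
theorem chord_sq {R ox oy px py qx qy : ℝ} (hp : (px - ox) ^ 2 + (py - oy) ^ 2 = R ^ 2)
    (hq : (qx - ox) ^ 2 + (qy - oy) ^ 2 = R ^ 2) :
    R ^ 2 * ((px - qx) ^ 2 + (py - qy) ^ 2)
        - ((px - ox) * (qy - oy) - (py - oy) * (qx - ox)) ^ 2 =
      ((px - qx) ^ 2 + (py - qy) ^ 2) ^ 2 / 4 := by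
  linear_combination (((px - ox) * (qx - ox) + (py - oy) * (qy - oy))
      - ((px - ox) ^ 2 + (py - oy) ^ 2 + (qx - ox) ^ 2 + (qy - oy) ^ 2) / 2) * (hp + hq)
    + ((px - ox) ^ 2 + (py - oy) ^ 2 - (qx - ox) ^ 2 - (qy - oy) ^ 2) / 4 * (hp - hq)

/-- Barycentric weights are ratios of areas; those of the symmedian point are the squared sides. -/
theorem sideSqSum_mul_crossAt_X6 (T : Tri) :
    sideSqSum T * crossAt (X6 T) (T.points 1) (T.points 2) = sideLength T 0 ^ 2 * doubleArea T ∧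
    sideSqSum T * crossAt (X6 T) (T.points 2) (T.points 0) = sideLength T 1 ^ 2 * doubleArea T ∧
    sideSqSum T * crossAt (X6 T) (T.points 0) (T.points 1) = sideLength T 2 ^ 2 * doubleArea T := by
  have h0 := sideSqSum_mul_X6 T 0
  have h1 := sideSqSum_mul_X6 T 1
  have hσ : sideSqSum T = sideLength T 0 ^ 2 + sideLength T 1 ^ 2 + sideLength T 2 ^ 2 := rfl
  unfold doubleArea crossAt
  refine ⟨?_, ?_, ?_⟩
  · linear_combination (T.points 1 1 - T.points 2 1) * h0 + (T.points 2 0 - T.points 1 0) * h1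
      + (T.points 1 0 * T.points 2 1 - T.points 1 1 * T.points 2 0) * hσ
  · linear_combination (T.points 2 1 - T.points 0 1) * h0 + (T.points 0 0 - T.points 2 0) * h1
      + (T.points 2 0 * T.points 0 1 - T.points 2 1 * T.points 0 0) * hσ
  · linear_combination (T.points 0 1 - T.points 1 1) * h0 + (T.points 1 0 - T.points 0 0) * h1
      + (T.points 0 0 * T.points 1 1 - T.points 0 1 * T.points 1 0) * hσ

/-- The dual conic of the Brocard inellipse at a chord `pq` of the circumcircle, in coordinates
with origin at the Brocard midpoint `s • o + (1 - s) • k`. -/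
theorem dual_conic_of_chord {R s ox oy kx ky px py qx qy : ℝ}
    (hp : (px - ox) ^ 2 + (py - oy) ^ 2 = R ^ 2) (hq : (qx - ox) ^ 2 + (qy - oy) ^ 2 = R ^ 2)
    (hx : s * ox + (1 - s) * kx = 0) (hy : s * oy + (1 - s) * ky = 0) :
    (1 - s) * ((1 - s) * ((px - kx) * (qy - ky) - (py - ky) * (qx - kx)) ^ 2
        - s * ((px - qx) ^ 2 + (py - qy) ^ 2) ^ 2 / 4) =
      (1 - s) * ((px * qy - py * qx) ^ 2 - s * R ^ 2 * ((px - qx) ^ 2 + (py - qy) ^ 2))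
        + s * (ox * (py - qy) - oy * (px - qx)) ^ 2 := by
  have hc := chord_sq hp hq
  -- The area over the chord is an affine function of the apex, and the origin divides the segment
  -- from `o` to `k`.
  have hk : (1 - s) * ((px - kx) * (qy - ky) - (py - ky) * (qx - kx)) =
      (1 - s) * (px * qy - py * qx) - s * (ox * (py - qy) - oy * (px - qx)) := by
    linear_combination (py - qy) * hx - (px - qx) * hy
  have hk2 : (1 - s) * ((1 - s) * ((px - kx) * (qy - ky) - (py - ky) * (qx - kx)) ^ 2) =
      ((1 - s) * (px * qy - py * qx) - s * (ox * (py - qy) - oy * (px - qx))) ^ 2 := by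
    rw [← hk]; ring
  linear_combination hk2 + (1 - s) * s * hc

/-- A binary quadratic form with three pairwise independent zeros vanishes. -/
theorem quadratic_form_eq_zero {α β γ u1 u2 v1 v2 : ℝ} (hne : u1 * v2 - u2 * v1 ≠ 0)
    (hu : α * u1 ^ 2 + β * (u1 * u2) + γ * u2 ^ 2 = 0)
    (hv : α * v1 ^ 2 + β * (v1 * v2) + γ * v2 ^ 2 = 0)
    (hw : α * (u1 + v1) ^ 2 + β * ((u1 + v1) * (u2 + v2)) + γ * (u2 + v2) ^ 2 = 0) :
    α = 0 ∧ β = 0 ∧ γ = 0 := by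
  have hsq : (u1 * v2 - u2 * v1) ^ 2 ≠ 0 := pow_ne_zero 2 hne
  refine ⟨(mul_eq_zero.1 (?_ : (u1 * v2 - u2 * v1) ^ 2 * α = 0)).resolve_left hsq,
    (mul_eq_zero.1 (?_ : (u1 * v2 - u2 * v1) ^ 2 * β = 0)).resolve_left hsq,
    (mul_eq_zero.1 (?_ : (u1 * v2 - u2 * v1) ^ 2 * γ = 0)).resolve_left hsq⟩
  · linear_combination v2 ^ 2 * hu + u2 ^ 2 * hv - u2 * v2 * (hw - hu - hv)
  · linear_combination -2 * v1 * v2 * hu - 2 * u1 * u2 * hv + (u1 * v2 + u2 * v1) * (hw - hu - hv)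
  · linear_combination v1 ^ 2 * hu + u1 ^ 2 * hv - u1 * v1 * (hw - hu - hv)

theorem points_ne (T : Tri) {i j : Fin 3} (h : i ≠ j) : T.points i ≠ T.points j :=
  fun e => h (T.independent.injective e)

/-- The data of a circle `S` and an ellipse in standard position that determine a Brocard porism;
`s` is the squared sine of the Brocard angle. -/
structure IsStdPair (a b s : ℝ) (S : EuclideanGeometry.Sphere Plane) : Prop where
  radius_pos : 0 < S.radius
  pos : 0 < s
  lt_one : s < 1
  center_zero : S.center 0 = 0
  center_one_sq : S.center 1 ^ 2 = S.radius ^ 2 * (1 - s) * (1 - 4 * s)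
  a_sq : a ^ 2 = s * S.radius ^ 2
  b_eq : b = 2 * s * S.radius

theorem IsStdPair.one_sub_four_mul_nonneg {a b s : ℝ} {S : EuclideanGeometry.Sphere Plane}
    (h : IsStdPair a b s S) : 0 ≤ 1 - 4 * s := by
  have h1 : 0 < S.radius ^ 2 * (1 - s) :=
    mul_pos (pow_pos h.radius_pos 2) (sub_pos.2 h.lt_one)
  have h2 : 0 ≤ S.radius ^ 2 * (1 - s) * (1 - 4 * s) := h.center_one_sq ▸ sq_nonneg _
  exact nonneg_of_mul_nonneg_right h2 h1

/-- The three tangency conditions of a triangle whose side lines touch a standard ellipse. -/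
theorem tangent_sides {a b : ℝ} (ha : 0 < a) (hb : 0 < b) {T : Tri}
    (h : ∀ i : Fin 3, ∃ D, (sideLine T i : Set Plane) ∩ stdEllipse a b = {D}) (i j : Fin 3)
    (hij : i ≠ j) :
    a ^ 2 * (T.points i 1 - T.points j 1) ^ 2 + b ^ 2 * (T.points i 0 - T.points j 0) ^ 2 =
      (T.points i 0 * T.points j 1 - T.points i 1 * T.points j 0) ^ 2 := by
  have h0 := (line_inter_stdEllipse_eq_singleton_iff ha hb
    (points_ne T (show (1 : Fin 3) ≠ 2 by decide))).1 (h 0)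
  have h1 := (line_inter_stdEllipse_eq_singleton_iff ha hb
    (points_ne T (show (2 : Fin 3) ≠ 0 by decide))).1 (h 1)
  have h2 := (line_inter_stdEllipse_eq_singleton_iff ha hb
    (points_ne T (show (0 : Fin 3) ≠ 1 by decide))).1 (h 2)
  fin_cases i <;> fin_cases j <;> first | exact absurd rfl hij | skip
  · simpa using h2
  · simp only [Fin.zero_eta, Fin.reduceFinMk]; linear_combination h1
  · simp only [Fin.zero_eta, Fin.mk_one]; linear_combination h2
  · simpa using h0
  · simpa using h1
  · simp only [Fin.mk_one, Fin.reduceFinMk]; linear_combination h0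

/-- The area ratios of the symmedian point and the tangency conditions make the three side
directions zeros of one quadratic form, with coefficients in `a`, `b`, `s` and the circle. The form
therefore vanishes, and its coefficients give the normal form; `power_X6` gives the distance from
the circumcenter to the origin. -/
theorem IsBrocardPair.exists_isStdPair {a b : ℝ} (hb : 0 < b) (hab : b ≤ a)
    {S : EuclideanGeometry.Sphere Plane} (h : IsBrocardPair S (stdEllipse a b)) :
    ∃ s, IsStdPair a b s S := by
  obtain ⟨T, hS, hE, htan⟩ := h
  have ha : 0 < a := hb.trans_le hab
  have hX := eq_zero_of_isEllipseAt_stdEllipse ha hb hE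
  have hR := radius_pos hS
  have hδ := doubleArea_ne_zero T
  have hσ := sideSqSum_pos T
  have hq := sideSqPairSum_pos T
  have hher := four_mul_doubleArea_sq T
  obtain ⟨s, hsdef⟩ : ∃ s, s = doubleArea T ^ 2 / sideSqPairSum T := ⟨_, rfl⟩
  have hsq : doubleArea T ^ 2 = s * sideSqPairSum T := by rw [hsdef]; field_simp
  have hs0 : 0 < s := by
    rw [hsdef]
    have : 0 < doubleArea T ^ 2 := by positivity
    positivity
  have hsσ : sideSqSum T ^ 2 = 4 * (1 - s) * sideSqPairSum T := by
    linear_combination hher - 4 * hsq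
  have hs1 : 0 < 1 - s := by
    have : 0 < 4 * (1 - s) * sideSqPairSum T := hsσ ▸ pow_pos hσ 2
    have := pos_of_mul_pos_left this hq.le
    linarith
  have hOK : ∀ j, s * S.center j + (1 - s) * X6 T j = 0 := by
    intro j
    have := sideSqPairSum_mul_X39_eq hS j
    rw [hX, hsσ] at this
    simp only [PiLp.zero_apply, mul_zero] at this
    have h4 : 4 * sideSqPairSum T * (s * S.center j + (1 - s) * X6 T j) = 0 := by
      linear_combination -this - 4 * S.center j * hsq
    exact (mul_eq_zero.1 h4).resolve_left (by positivity)
  have hcirc := circumsphere_sq hS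
  have hn := sideSqSum_mul_crossAt_X6 T
  -- `n` stands for the doubled area over a side seen from `X6 T`, and `l` for that squared side.
  have hnn : ∀ n l : ℝ, sideSqSum T * n = l * doubleArea T → (1 - s) * n ^ 2 - s * l ^ 2 / 4 = 0 := by
    intro n l hnl
    have h4 : 4 * sideSqPairSum T * ((1 - s) * n ^ 2 - s * l ^ 2 / 4) = 0 := by
      have : (sideSqSum T * n) ^ 2 = (l * doubleArea T) ^ 2 := by rw [hnl]
      linear_combination this - n ^ 2 * hsσ + l ^ 2 * hsq
    exact (mul_eq_zero.1 h4).resolve_left (by positivity)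
  have htan' : ∀ i : Fin 3, ∃ D, (sideLine T i : Set Plane) ∩ stdEllipse a b = {D} :=
    fun i => let ⟨D, _, hD⟩ := htan i; ⟨D, hD⟩
  have hform : ∀ i j : Fin 3, i ≠ j → ∀ l : ℝ,
      sideSqSum T * crossAt (X6 T) (T.points i) (T.points j) = l * doubleArea T →
      l = (T.points i 0 - T.points j 0) ^ 2 + (T.points i 1 - T.points j 1) ^ 2 →
      ((1 - s) * (b ^ 2 - s * S.radius ^ 2) + s * S.center 1 ^ 2)
          * (T.points i 0 - T.points j 0) ^ 2
        + (-2 * s * (S.center 0 * S.center 1))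
          * ((T.points i 0 - T.points j 0) * (T.points i 1 - T.points j 1))
        + ((1 - s) * (a ^ 2 - s * S.radius ^ 2) + s * S.center 0 ^ 2)
          * (T.points i 1 - T.points j 1) ^ 2 = 0 := by
    intro i j hij l hl hl'
    have e1 := dual_conic_of_chord (hcirc i) (hcirc j) (hOK 0) (hOK 1)
    have e2 := hnn _ _ hl
    have e3 := tangent_sides ha hb htan' i j hij
    rw [hl', crossAt] at e2
    linear_combination (1 - s) * e2 - e1 + (1 - s) * e3
  have f0 := hform 1 2 (by decide) _ hn.1 (sideLength_zero_sq T)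
  have f1 := hform 2 0 (by decide) _ hn.2.1 (sideLength_one_sq T)
  have f2 := hform 0 1 (by decide) _ hn.2.2 (sideLength_two_sq T)
  obtain ⟨hα, hβ, hγ⟩ := quadratic_form_eq_zero (by
    intro h0
    apply hδ
    unfold doubleArea crossAt
    linear_combination h0) f0 f1 (by linear_combination f2)
  have hpow := power_X6 hS
  have hO2 : S.center 0 ^ 2 + S.center 1 ^ 2 = S.radius ^ 2 * (1 - s) * (1 - 4 * s) := by
    have k : ∀ j, (1 - s) * (X6 T j - S.center j) = -S.center j := fun j => by
      linear_combination hOK j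
    have h5 : 4 * sideSqPairSum T * ((1 - s) * ((1 - s) * S.radius ^ 2)
        - (S.center 0 ^ 2 + S.center 1 ^ 2) - 3 * s * (1 - s) * S.radius ^ 2) = 0 := by
      have k0 := congrArg (· ^ 2) (k 0)
      have k1 := congrArg (· ^ 2) (k 1)
      simp only at k0 k1
      linear_combination (1 - s) * hpow + 12 * (1 - s) * S.radius ^ 2 * hsq
        + 4 * sideSqPairSum T * (k0 + k1) - (1 - s) * (S.radius ^ 2
          - (X6 T 0 - S.center 0) ^ 2 - (X6 T 1 - S.center 1) ^ 2) * hsσ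
    have := (mul_eq_zero.1 h5).resolve_left (by positivity)
    linear_combination -this
  -- A center off the minor axis would lie on the major axis by the mixed coefficient; the
  -- difference of the diagonal coefficients would then be positive, since `b ≤ a`.
  have hO0 : S.center 0 = 0 := by
    by_contra hne
    have h1 : S.center 1 = 0 := by
      have h6 : (-2 * s * S.center 0) * S.center 1 = 0 := by linear_combination hβ
      exact (mul_eq_zero.1 h6).resolve_left (mul_ne_zero (by linarith) hne)
    rw [h1] at hα
    have h7 : (1 - s) * (a ^ 2 - b ^ 2) + s * S.center 0 ^ 2 = 0 := by
      linear_combination hγ - hα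
    have h8 : 0 ≤ (1 - s) * (a ^ 2 - b ^ 2) :=
      mul_nonneg hs1.le (sub_nonneg.2 (pow_le_pow_left₀ hb.le hab 2))
    have h9 : 0 < s * S.center 0 ^ 2 := by positivity
    linarith
  rw [hO0] at hγ hO2
  refine ⟨s, hR, hs0, by linarith, hO0, by linear_combination hO2, ?_, ?_⟩
  · have : (1 - s) * (a ^ 2 - s * S.radius ^ 2) = 0 := by linear_combination hγ
    have := (mul_eq_zero.1 this).resolve_left hs1.ne'
    linarith
  · have h10 : (1 - s) * (b ^ 2 - (2 * s * S.radius) ^ 2) = 0 := by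
      linear_combination hα - s * hO2
    have h11 := (mul_eq_zero.1 h10).resolve_left hs1.ne'
    have h12 : b ^ 2 = (2 * s * S.radius) ^ 2 := by linarith
    exact (sq_eq_sq₀ hb.le (by positivity)).1 h12

/-! ### Invariance of the symmedian point and the Brocard angle. -/

/-- Three weights that are proportional to `A, B, C` up to signs are proportional to them if the
given quadratic form is positive. -/
theorem weights_proportional {A B C n0 n1 n2 r s : ℝ} (hA : 0 < A) (hB : 0 < B) (hC : 0 < C)
    (hr : 0 < r) (h0 : r * n0 ^ 2 = s * A ^ 2) (h1 : r * n1 ^ 2 = s * B ^ 2)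
    (h2 : r * n2 ^ 2 = s * C ^ 2) (hpos : 0 < n1 * n2 * A + n2 * n0 * B + n0 * n1 * C) :
    ∃ t, n0 = t * A ∧ n1 = t * B ∧ n2 = t * C := by
  obtain ⟨t, ht⟩ : ∃ t, n0 = t * A := ⟨n0 / A, by field_simp⟩
  have hst : s = r * t ^ 2 := by
    have : A ^ 2 * (s - r * t ^ 2) = 0 := by rw [ht] at h0; linear_combination -h0
    have := (mul_eq_zero.1 this).resolve_left (by positivity)
    linarith
  have e1 : n1 ^ 2 = (t * B) ^ 2 := mul_left_cancel₀ hr.ne' (by rw [h1, hst]; ring)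
  have e2 : n2 ^ 2 = (t * C) ^ 2 := mul_left_cancel₀ hr.ne' (by rw [h2, hst]; ring)
  have hp : 0 ≤ t ^ 2 * (A * B * C) := by positivity
  rcases sq_eq_sq_iff_eq_or_eq_neg.1 e1 with e1 | e1 <;>
    rcases sq_eq_sq_iff_eq_or_eq_neg.1 e2 with e2 | e2
  · exact ⟨t, ht, e1, e2⟩
  -- Each other sign pattern makes the quadratic form equal to `-t² A B C`.
  all_goals
    exfalso
    rw [ht, e1, e2] at hpos
    ring_nf at hpos hp
    linarith

/-- All triangles of the porism have the same symmedian point and the same Brocard angle. -/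
theorem IsStdPair.X6_of_mem_family {a b s : ℝ} (ha : 0 < a) (hb : 0 < b)
    {S : EuclideanGeometry.Sphere Plane} (h : IsStdPair a b s S) {T : Tri}
    (hT : T ∈ family S (stdEllipse a b)) :
    X6 T 0 = 0 ∧ (1 - s) * X6 T 1 = -s * S.center 1 ∧
      sideSqSum T ^ 2 = 4 * (1 - s) * sideSqPairSum T := by
  obtain ⟨hS, htan⟩ := hT
  have hs1 : 0 < 1 - s := sub_pos.2 h.lt_one
  have hR := h.radius_pos
  have hs0 := h.pos
  have hδ := doubleArea_ne_zero T
  have hσ := sideSqSum_pos T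
  -- `K` is the point determined by the pair alone, with the origin equal to `s • S.center + (1 - s)
  -- • K`; it will turn out to be `X6 T`.
  obtain ⟨K, hK0, hK1⟩ : ∃ K : Plane, K 0 = 0 ∧ (1 - s) * K 1 = -s * S.center 1 :=
    ⟨!₂[0, -s * S.center 1 / (1 - s)], rfl, by
      show (1 - s) * (-s * S.center 1 / (1 - s)) = _
      field_simp⟩
  have hcirc := circumsphere_sq hS
  -- Tangency, read through `dual_conic_of_chord`, makes the areas seen from `K` proportional to the
  -- squared sides up to sign.
  have hside : ∀ i j : Fin 3, i ≠ j → ∀ l : ℝ,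
      l = (T.points i 0 - T.points j 0) ^ 2 + (T.points i 1 - T.points j 1) ^ 2 →
      (4 * (1 - s)) * crossAt K (T.points i) (T.points j) ^ 2 = s * l ^ 2 := by
    intro i j hij l hl
    have e1 := dual_conic_of_chord (s := s) (kx := K 0) (ky := K 1) (hcirc i) (hcirc j)
      (by rw [h.center_zero, hK0]; ring) (by rw [hK1]; ring)
    have e2 := tangent_sides ha hb htan i j hij
    rw [h.a_sq, h.b_eq] at e2
    rw [h.center_zero] at e1
    have e3 : (1 - s) * ((1 - s) * crossAt K (T.points i) (T.points j) ^ 2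
        - s * ((T.points i 0 - T.points j 0) ^ 2 + (T.points i 1 - T.points j 1) ^ 2) ^ 2 / 4)
        = 0 := by
      unfold crossAt
      linear_combination e1 - (1 - s) * e2
        + s * (T.points i 0 - T.points j 0) ^ 2 * h.center_one_sq
    have e4 := (mul_eq_zero.1 e3).resolve_left hs1.ne'
    rw [hl]
    linear_combination 4 * e4
  have n0 := hside 1 2 (by decide) _ (sideLength_zero_sq T)
  have n1 := hside 2 0 (by decide) _ (sideLength_one_sq T)
  have n2 := hside 0 1 (by decide) _ (sideLength_two_sq T)
  have hsum : crossAt K (T.points 1) (T.points 2) + crossAt K (T.points 2) (T.points 0)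
      + crossAt K (T.points 0) (T.points 1) = doubleArea T := by
    unfold doubleArea crossAt; ring
  have hK : ∀ j, doubleArea T * K j = crossAt K (T.points 1) (T.points 2) * T.points 0 j
      + crossAt K (T.points 2) (T.points 0) * T.points 1 j
      + crossAt K (T.points 0) (T.points 1) * T.points 2 j := by
    intro j
    unfold doubleArea crossAt
    fin_cases j
    · simp only [Fin.zero_eta]; ring
    · simp only [Fin.mk_one]; ring
  have hpow := power_of_weights_triangle hS hsum hK
  -- `K` lies inside the circle; this positive power makes the signs of the three areas agree.
  have hpos : 0 < S.radius ^ 2 - (K 0 - S.center 0) ^ 2 - (K 1 - S.center 1) ^ 2 := by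
    have e : (1 - s) * (S.radius ^ 2 - (K 0 - S.center 0) ^ 2 - (K 1 - S.center 1) ^ 2) =
        3 * s * S.radius ^ 2 := by
      rw [hK0, h.center_zero]
      have k : (1 - s) * (K 1 - S.center 1) = -S.center 1 := by linear_combination hK1
      have k2 : (1 - s) * ((1 - s) * (K 1 - S.center 1) ^ 2) = (-S.center 1) ^ 2 := by
        rw [← k]; ring
      rw [neg_sq, h.center_one_sq] at k2
      have k3 : (1 - s) * (K 1 - S.center 1) ^ 2 = S.radius ^ 2 * (1 - 4 * s) :=
        mul_left_cancel₀ hs1.ne' (by rw [k2]; ring)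
      linear_combination -k3
    have : 0 < 3 * s * S.radius ^ 2 := by positivity
    rw [← e] at this
    exact pos_of_mul_pos_right this hs1.le
  have hpos' : 0 < doubleArea T ^ 2
      * (S.radius ^ 2 - (K 0 - S.center 0) ^ 2 - (K 1 - S.center 1) ^ 2) := by positivity
  rw [hpow] at hpos'
  have hl := sideLength_pos T
  obtain ⟨t, t0, t1, t2⟩ := weights_proportional (pow_pos (hl 0) 2) (pow_pos (hl 1) 2)
    (pow_pos (hl 2) 2) (by positivity) n0 n1 n2 hpos'
  rw [t0, t1, t2] at hsum
  have htσ : doubleArea T = t * sideSqSum T := by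
    rw [← hsum]; unfold sideSqSum; ring
  have ht : t ≠ 0 := fun h0 => hδ (by rw [htσ, h0, zero_mul])
  have hX : ∀ j, X6 T j = K j := by
    intro j
    have e1 := sideSqSum_mul_X6 T j
    have e2 := hK j
    rw [t0, t1, t2, htσ] at e2
    apply mul_left_cancel₀ (mul_ne_zero ht hσ.ne')
    linear_combination t * e1 - e2
  refine ⟨by rw [hX, hK0], by rw [hX, hK1], ?_⟩
  have hher := four_mul_doubleArea_sq T
  rw [t0] at n0
  have hst : 4 * (1 - s) * t ^ 2 = s := by
    apply mul_right_cancel₀ (pow_ne_zero 2 (pow_ne_zero 2 (hl 0).ne'))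
    linear_combination n0
  rw [htσ] at hher
  linear_combination (-sideSqSum T ^ 2) * hst + (1 - s) * hher

/-! ### Projective images of equilateral triangles. -/

/-- Converts tangency in line coefficients to the form for two points: `p - q` is a multiple of
`(-l1, l0)`, and `p × q` is `-n` times the same multiple. -/
theorem dual_conic_of_line {a b l0 l1 n px py qx qy : ℝ} (hl : l0 ^ 2 + l1 ^ 2 ≠ 0)
    (hp : l0 * px + l1 * py = n) (hq : l0 * qx + l1 * qy = n)
    (h : a ^ 2 * l0 ^ 2 + b ^ 2 * l1 ^ 2 = n ^ 2) :
    a ^ 2 * (py - qy) ^ 2 + b ^ 2 * (px - qx) ^ 2 = (px * qy - py * qx) ^ 2 := by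
  have he : (l0 ^ 2 + l1 ^ 2) * (px - qx) = -l1 * (l0 * (py - qy) - l1 * (px - qx)) := by
    linear_combination l0 * (hp - hq)
  have hf : (l0 ^ 2 + l1 ^ 2) * (py - qy) = l0 * (l0 * (py - qy) - l1 * (px - qx)) := by
    linear_combination l1 * (hp - hq)
  have hc : (l0 ^ 2 + l1 ^ 2) * (px * qy - py * qx) = -n * (l0 * (py - qy) - l1 * (px - qx)) := by
    linear_combination -px * hf + py * he - (l0 * (py - qy) - l1 * (px - qx)) * hp
  apply mul_left_cancel₀ (pow_ne_zero 2 hl)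
  calc (l0 ^ 2 + l1 ^ 2) ^ 2 * (a ^ 2 * (py - qy) ^ 2 + b ^ 2 * (px - qx) ^ 2)
      = a ^ 2 * ((l0 ^ 2 + l1 ^ 2) * (py - qy)) ^ 2
        + b ^ 2 * ((l0 ^ 2 + l1 ^ 2) * (px - qx)) ^ 2 := by ring
    _ = (-n * (l0 * (py - qy) - l1 * (px - qx))) ^ 2 := by
        rw [he, hf]
        linear_combination (l0 * (py - qy) - l1 * (px - qx)) ^ 2 * h
    _ = _ := by rw [← hc]; ring

/-- The image of the point `(x, y)` of the unit circle under the projective map that sends the unit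
disk to the disk with center `(0, o)` and radius `R`, and the origin to `(0, o + k * R)`. -/
noncomputable def diskMap (o R k x y : ℝ) : Plane :=
  !₂[R * (√(1 - k ^ 2) * x / (1 + k * y)), o + R * ((y + k) / (1 + k * y))]

section

variable {o R k : ℝ}

theorem one_add_mul_pos (hk : k ^ 2 < 1) {x y : ℝ} (hxy : x ^ 2 + y ^ 2 = 1) : 0 < 1 + k * y := by
  nlinarith [sq_nonneg (k + y), sq_nonneg x]

theorem diskMap_mem_circle (hk : k ^ 2 < 1) {x y : ℝ} (hxy : x ^ 2 + y ^ 2 = 1) :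
    (diskMap o R k x y 0 - 0) ^ 2 + (diskMap o R k x y 1 - o) ^ 2 = R ^ 2 := by
  have h1 := (one_add_mul_pos hk hxy).ne'
  have h2 : √(1 - k ^ 2) ^ 2 = 1 - k ^ 2 := Real.sq_sqrt (by linarith)
  have e0 : diskMap o R k x y 0 = R * (√(1 - k ^ 2) * x / (1 + k * y)) := rfl
  have e1 : diskMap o R k x y 1 = o + R * ((y + k) / (1 + k * y)) := rfl
  rw [e0, e1]
  field_simp
  linear_combination R ^ 2 * x ^ 2 * h2 + R ^ 2 * (1 - k ^ 2) * hxy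

/-- The line through the images of two vertices of an equilateral triangle with third vertex
`(x', y')`. -/
theorem diskMap_mem_line (hk : k ^ 2 < 1) {x y x' y' : ℝ} (hxy : x ^ 2 + y ^ 2 = 1)
    (h : x * x' + y * y' = -1 / 2) :
    √(1 - k ^ 2) * x' * diskMap o R k x y 0 + (y' - k / 2) * diskMap o R k x y 1 =
      R * (k * y' - 1 / 2) + (y' - k / 2) * o := by
  have h1 := (one_add_mul_pos hk hxy).ne'
  have h2 : √(1 - k ^ 2) ^ 2 = 1 - k ^ 2 := Real.sq_sqrt (by linarith)
  have e0 : diskMap o R k x y 0 = R * (√(1 - k ^ 2) * x / (1 + k * y)) := rfl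
  have e1 : diskMap o R k x y 1 = o + R * ((y + k) / (1 + k * y)) := rfl
  rw [e0, e1]
  field_simp
  linear_combination 2 * R * x * x' * h2 + 2 * R * (1 - k ^ 2) * h

theorem diskMap_ne (hR : 0 < R) (hk : k ^ 2 < 1) {x y x' y' : ℝ} (hxy : x ^ 2 + y ^ 2 = 1)
    (hxy' : x' ^ 2 + y' ^ 2 = 1) (h : x * x' + y * y' = -1 / 2) :
    diskMap o R k x y ≠ diskMap o R k x' y' := by
  intro he
  have h1 := (one_add_mul_pos hk hxy).ne'
  have h1' := (one_add_mul_pos hk hxy').ne'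
  have h2 : √(1 - k ^ 2) ≠ 0 := (Real.sqrt_pos.2 (by linarith)).ne'
  have e0 : R * (√(1 - k ^ 2) * x / (1 + k * y)) = R * (√(1 - k ^ 2) * x' / (1 + k * y')) :=
    congrArg (fun p : Plane => p 0) he
  have e1 : o + R * ((y + k) / (1 + k * y)) = o + R * ((y' + k) / (1 + k * y')) :=
    congrArg (fun p : Plane => p 1) he
  have e1' := mul_left_cancel₀ hR.ne' (add_left_cancel e1)
  rw [div_eq_div_iff h1 h1'] at e1'
  have hy : y = y' := by
    have : (1 - k ^ 2) * (y - y') = 0 := by linear_combination e1'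
    have := (mul_eq_zero.1 this).resolve_left (by linarith)
    linarith
  subst hy
  have e0' := mul_left_cancel₀ hR.ne' e0
  have hx : x = x' := by
    rw [div_left_inj' h1] at e0'
    exact mul_left_cancel₀ h2 e0'
  subst hx
  nlinarith

end

/-- The data of a Brocard porism in terms of the position `k` of the symmedian point. -/
theorem IsStdPair.exists_param {a b s : ℝ} {S : EuclideanGeometry.Sphere Plane}
    (h : IsStdPair a b s S) :
    ∃ k, k ^ 2 < 1 ∧ s = (1 - k ^ 2) / (4 - k ^ 2) ∧
      S.center 1 = -(3 * k * S.radius / (4 - k ^ 2)) := by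
  have hs1 : 0 < 1 - s := sub_pos.2 h.lt_one
  have hR := h.radius_pos
  have hs0 := h.pos
  have h14 := h.one_sub_four_mul_nonneg
  -- With the Brocard midpoint at the origin, `(1 - s) (K - O) = -O`; hence `k` is the offset of `K`
  -- from `O` along the minor axis, in units of the radius.
  obtain ⟨k, hk⟩ : ∃ k, k = -S.center 1 / ((1 - s) * S.radius) := ⟨_, rfl⟩
  have ho : S.center 1 = -((1 - s) * k * S.radius) := by rw [hk]; field_simp
  have hk2 : (1 - s) * k ^ 2 = 1 - 4 * s := by
    have := h.center_one_sq
    rw [ho] at this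
    apply mul_left_cancel₀ (show S.radius ^ 2 * (1 - s) ≠ 0 by positivity)
    linear_combination this
  have hlt : k ^ 2 < 1 := by
    by_contra hcon
    nlinarith
  have h4 : 4 - k ^ 2 ≠ 0 := by linarith
  refine ⟨k, hlt, ?_, ?_⟩
  · field_simp
    linear_combination hk2
  · rw [ho]
    field_simp
    linear_combination k * hk2

theorem exists_tri_of_cospherical {S : EuclideanGeometry.Sphere Plane} {p0 p1 p2 : Plane}
    (h0 : dist p0 S.center = S.radius) (h1 : dist p1 S.center = S.radius)
    (h2 : dist p2 S.center = S.radius) (h01 : p0 ≠ p1) (h02 : p0 ≠ p2) (h12 : p1 ≠ p2) :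
    ∃ T : Tri, T.circumsphere = S ∧ T.points 0 = p0 ∧ T.points 1 = p1 ∧ T.points 2 = p2 := by
  have hc : EuclideanGeometry.Cospherical ({p0, p1, p2} : Set Plane) := by
    refine ⟨S.center, S.radius, ?_⟩
    rintro p (rfl | rfl | rfl)
    · exact h0
    · exact h1
    · exact h2
  refine ⟨⟨![p0, p1, p2], hc.affineIndependent_of_ne h01 h02 h12⟩, ?_, rfl, rfl, rfl⟩
  rw [circumsphere_eq_iff]
  intro i
  fin_cases i
  · exact h0
  · exact h1
  · exact h2

theorem mem_family_of_tangent {a b : ℝ} (ha : 0 < a) (hb : 0 < b)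
    {S : EuclideanGeometry.Sphere Plane} {T : Tri} (hS : T.circumsphere = S)
    (h : ∀ i j : Fin 3, i ≠ j →
      a ^ 2 * (T.points i 1 - T.points j 1) ^ 2 + b ^ 2 * (T.points i 0 - T.points j 0) ^ 2 =
        (T.points i 0 * T.points j 1 - T.points i 1 * T.points j 0) ^ 2) :
    T ∈ family S (stdEllipse a b) := by
  refine ⟨hS, fun i => ?_⟩
  have hne : i + 1 ≠ i + 2 := by revert i; decide
  exact (line_inter_stdEllipse_eq_singleton_iff ha hb (points_ne T hne)).2 (h _ _ hne)

/-- The image of an equilateral triangle inscribed in the unit circle belongs to the porism. -/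
theorem IsStdPair.exists_mem_family {a b s k : ℝ} (ha : 0 < a) (hb : 0 < b)
    {S : EuclideanGeometry.Sphere Plane} (h : IsStdPair a b s S) (hk : k ^ 2 < 1)
    (hs : s = (1 - k ^ 2) / (4 - k ^ 2)) (ho : S.center 1 = -(3 * k * S.radius / (4 - k ^ 2)))
    {x y r : ℝ} (hxy : x ^ 2 + y ^ 2 = 1) (hr : r ^ 2 = 3 / 4) :
    ∃ T ∈ family S (stdEllipse a b),
      T.points 0 = diskMap (S.center 1) S.radius k x y ∧
      T.points 1 = diskMap (S.center 1) S.radius k (-x / 2 + r * y) (-y / 2 - r * x) ∧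
      T.points 2 = diskMap (S.center 1) S.radius k (-x / 2 - r * y) (-y / 2 + r * x) := by
  have hR := h.radius_pos
  have hdist : ∀ x y : ℝ, x ^ 2 + y ^ 2 = 1 →
      dist (diskMap (S.center 1) S.radius k x y) S.center = S.radius := by
    intro x y hxy
    apply (sq_eq_sq₀ dist_nonneg hR.le).1
    rw [dist_sq_eq, h.center_zero]
    exact diskMap_mem_circle hk hxy
  -- As `r = ±√3/2`, the two other points are rotations of `(x, y)` by a third of a turn in either
  -- direction.
  have hxy1 : (-x / 2 + r * y) ^ 2 + (-y / 2 - r * x) ^ 2 = 1 := by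
    linear_combination (1 / 4 + r ^ 2) * hxy + hr
  have hxy2 : (-x / 2 - r * y) ^ 2 + (-y / 2 + r * x) ^ 2 = 1 := by
    linear_combination (1 / 4 + r ^ 2) * hxy + hr
  have i01 : x * (-x / 2 + r * y) + y * (-y / 2 - r * x) = -1 / 2 := by
    linear_combination (-1 / 2) * hxy
  have i02 : x * (-x / 2 - r * y) + y * (-y / 2 + r * x) = -1 / 2 := by
    linear_combination (-1 / 2) * hxy
  have i12 : (-x / 2 + r * y) * (-x / 2 - r * y) + (-y / 2 - r * x) * (-y / 2 + r * x)
      = -1 / 2 := by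
    linear_combination (1 / 4 - r ^ 2) * hxy - hr
  have hline : ∀ x y x1 y1 x2 y2 : ℝ, x ^ 2 + y ^ 2 = 1 → x1 ^ 2 + y1 ^ 2 = 1 →
      x2 ^ 2 + y2 ^ 2 = 1 → x * x1 + y * y1 = -1 / 2 → x * x2 + y * y2 = -1 / 2 →
      ∀ P Q : Plane, P = diskMap (S.center 1) S.radius k x1 y1 →
        Q = diskMap (S.center 1) S.radius k x2 y2 →
      a ^ 2 * (P 1 - Q 1) ^ 2 + b ^ 2 * (P 0 - Q 0) ^ 2 = (P 0 * Q 1 - P 1 * Q 0) ^ 2 := by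
    rintro x y x1 y1 x2 y2 e e1 e2 i1 i2 P Q rfl rfl
    have h2 : √(1 - k ^ 2) ^ 2 = 1 - k ^ 2 := Real.sq_sqrt (by linarith)
    have h4 : 4 - k ^ 2 ≠ 0 := by linarith
    refine dual_conic_of_line ?_
      (diskMap_mem_line hk e1 (x' := x) (y' := y) (by linear_combination i1))
      (diskMap_mem_line hk e2 (x' := x) (y' := y) (by linear_combination i2)) ?_
    -- If both line coefficients vanished, then `x = 0` and `y = k / 2`, which is off the unit
    -- circle because `k ^ 2 < 1`.
    · intro h0
      rw [mul_pow, h2] at h0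
      have hx := mul_nonneg (sub_nonneg.2 hk.le) (sq_nonneg x)
      have hx0 : x ^ 2 = 0 := (mul_eq_zero.1 (by linarith [sq_nonneg (y - k / 2)] :
        (1 - k ^ 2) * x ^ 2 = 0)).resolve_left (by linarith)
      have hy0 : y - k / 2 = 0 := (pow_eq_zero_iff two_ne_zero).1 (by linarith [sq_nonneg (y - k / 2)])
      have hy : y = k / 2 := by linarith
      rw [hx0, hy] at e
      linarith
    · rw [h.a_sq, h.b_eq, ho, hs, mul_pow, h2]
      have hx : x ^ 2 = 1 - y ^ 2 := by linarith
      rw [hx]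
      field_simp
      ring
  obtain ⟨T, hS, t0, t1, t2⟩ := exists_tri_of_cospherical (hdist _ _ hxy) (hdist _ _ hxy1)
    (hdist _ _ hxy2) (diskMap_ne hR hk hxy hxy1 i01) (diskMap_ne hR hk hxy hxy2 i02)
    (diskMap_ne hR hk hxy1 hxy2 i12)
  have k01 := hline _ _ _ _ _ _ hxy2 hxy hxy1 (by linear_combination i02)
    (by linear_combination i12) _ _ t0 t1
  have k12 := hline _ _ _ _ _ _ hxy hxy1 hxy2 i01 i02 _ _ t1 t2
  have k20 := hline _ _ _ _ _ _ hxy1 hxy2 hxy i12 (by linear_combination i01) _ _ t2 t0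
  refine ⟨T, mem_family_of_tangent ha hb hS ?_, t0, t1, t2⟩
  intro i j hij
  fin_cases i <;> fin_cases j <;> first | exact absurd rfl hij | skip
  · simpa using k01
  · simp only [Fin.zero_eta, Fin.reduceFinMk]; linear_combination k20
  · simp only [Fin.zero_eta, Fin.mk_one]; linear_combination k01
  · simpa using k12
  · simpa using k20
  · simp only [Fin.mk_one, Fin.reduceFinMk]; linear_combination k12

/-! ### The locus in standard position. -/

/-- Since `(1 - s) (K - O) = -O`, the center `O + (2/3) (1 - s) (K - O)` of `centroid_dist_sq` is
simply `O / 3`. -/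
theorem IsStdPair.centroid_mem {a b s : ℝ} (ha : 0 < a) (hb : 0 < b)
    {S : EuclideanGeometry.Sphere Plane} (h : IsStdPair a b s S) {T : Tri}
    (hT : T ∈ family S (stdEllipse a b)) :
    T.centroid 0 ^ 2 + (T.centroid 1 - S.center 1 / 3) ^ 2 =
      (S.radius * (1 - 4 * s) / 3) ^ 2 := by
  obtain ⟨e0, e1, e2⟩ := h.X6_of_mem_family ha hb hT
  have := centroid_dist_sq hT.1 e2
  rw [e0, h.center_zero] at this
  have k : S.center 1 + 2 / 3 * (1 - s) * (X6 T 1 - S.center 1) = S.center 1 / 3 := by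
    linear_combination 2 / 3 * e1
  rw [k] at this
  linear_combination this

theorem IsStdPair.locusX2_eq {a b s : ℝ} (ha : 0 < a) (hb : 0 < b)
    {S : EuclideanGeometry.Sphere Plane} (h : IsStdPair a b s S) :
    locusX2 S (stdEllipse a b) =
      Metric.sphere !₂[0, S.center 1 / 3] (S.radius * (1 - 4 * s) / 3) := by
  have hR := h.radius_pos
  have hρ : 0 ≤ S.radius * (1 - 4 * s) / 3 := by
    have := h.one_sub_four_mul_nonneg
    positivity
  have hmem : ∀ p : Plane, p ∈ Metric.sphere !₂[0, S.center 1 / 3] (S.radius * (1 - 4 * s) / 3) ↔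
      p 0 ^ 2 + (p 1 - S.center 1 / 3) ^ 2 = (S.radius * (1 - 4 * s) / 3) ^ 2 := by
    intro p
    rw [mem_sphere_iff_sq hρ]
    simp
  apply Set.Subset.antisymm
  · rintro _ ⟨T, hT, rfl⟩
    exact (hmem _).2 (h.centroid_mem ha hb hT)
  · intro p hp
    rw [hmem] at hp
    obtain ⟨k, hk, hs, ho⟩ := h.exists_param
    have h4 : 4 - k ^ 2 ≠ 0 := by linarith
    have hkl : -1 < k ∧ k < 1 := abs_lt.1 ((sq_lt_one_iff_abs_lt_one k).1 hk)
    obtain ⟨r, hr⟩ : ∃ r : ℝ, r ^ 2 = 3 / 4 := ⟨√(3 / 4), Real.sq_sqrt (by norm_num)⟩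
    have hu : ∀ x y : ℝ, x ^ 2 + y ^ 2 = 1 → 1 + k * y ≠ 0 := fun x y hxy =>
      (one_add_mul_pos hk hxy).ne'
    have hsc : ∀ θ : ℝ, Real.sin θ ^ 2 + Real.cos θ ^ 2 = 1 := Real.sin_sq_add_cos_sq
    -- `f θ` is the second coordinate of the centroid of the porism triangle coming from the
    -- equilateral triangle with vertex `(sin θ, cos θ)`.
    let f : ℝ → ℝ := fun θ =>
      (S.center 1 + S.radius * ((Real.cos θ + k) / (1 + k * Real.cos θ))
      + (S.center 1 + S.radius * ((-Real.cos θ / 2 - r * Real.sin θ + k)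
        / (1 + k * (-Real.cos θ / 2 - r * Real.sin θ))))
      + (S.center 1 + S.radius * ((-Real.cos θ / 2 + r * Real.sin θ + k)
        / (1 + k * (-Real.cos θ / 2 + r * Real.sin θ))))) / 3
    have hu1 : ∀ θ : ℝ, 1 + k * (-Real.cos θ / 2 - r * Real.sin θ) ≠ 0 := fun θ =>
      hu (-Real.sin θ / 2 + r * Real.cos θ) _ (by
        linear_combination (1 / 4 + r ^ 2) * hsc θ + hr)
    have hu2 : ∀ θ : ℝ, 1 + k * (-Real.cos θ / 2 + r * Real.sin θ) ≠ 0 := fun θ =>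
      hu (-Real.sin θ / 2 - r * Real.cos θ) _ (by
        linear_combination (1 / 4 + r ^ 2) * hsc θ + hr)
    have hcont : Continuous f := by
      have c0 : Continuous fun θ : ℝ => (Real.cos θ + k) / (1 + k * Real.cos θ) :=
        Continuous.div (by fun_prop) (by fun_prop) fun θ => hu _ _ (hsc θ)
      have c1 : Continuous fun θ : ℝ => (-Real.cos θ / 2 - r * Real.sin θ + k)
          / (1 + k * (-Real.cos θ / 2 - r * Real.sin θ)) :=
        Continuous.div (by fun_prop) (by fun_prop) hu1
      have c2 : Continuous fun θ : ℝ => (-Real.cos θ / 2 + r * Real.sin θ + k)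
          / (1 + k * (-Real.cos θ / 2 + r * Real.sin θ)) :=
        Continuous.div (by fun_prop) (by fun_prop) hu2
      fun_prop
    have hk1 : 1 + k ≠ 0 := by linarith
    have hk1' : 1 - k ≠ 0 := by linarith
    have hk2 : 2 - k ≠ 0 := by linarith
    have hk2' : 2 + k ≠ 0 := by linarith
    -- The angles `0` and `π` give isosceles triangles, whose centroids are the top and the bottom
    -- of the circle.
    have hf0 : f 0 = S.center 1 / 3 + S.radius * (1 - 4 * s) / 3 := by
      have e1 : (1 + k) / (1 + k * 1) = 1 := by rw [mul_one, div_self hk1]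
      have e2 : (-1 / 2 + k) / (1 + k * (-1 / 2)) = (2 * k - 1) / (2 - k) := by
        rw [div_eq_div_iff (by linarith) hk2]; ring
      simp only [f, Real.cos_zero, Real.sin_zero, mul_zero, sub_zero, add_zero]
      rw [e1, e2, ho, hs]
      have e3 : 4 - k ^ 2 = (2 - k) * (2 + k) := by ring
      rw [e3]
      field_simp
      ring
    have hfπ : f Real.pi = S.center 1 / 3 - S.radius * (1 - 4 * s) / 3 := by
      have e1 : (-1 + k) / (1 + k * -1) = -1 := by
        rw [div_eq_iff (by linarith)]; ring
      have e2 : (- -1 / 2 + k) / (1 + k * (- -1 / 2)) = (2 * k + 1) / (2 + k) := by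
        rw [div_eq_div_iff (by linarith) hk2']; ring
      simp only [f, Real.cos_pi, Real.sin_pi, mul_zero, sub_zero, add_zero]
      rw [e1, e2, ho, hs]
      have e3 : 4 - k ^ 2 = (2 - k) * (2 + k) := by ring
      rw [e3]
      field_simp
      ring
    have hp1 : p 1 ∈ Set.Icc (f Real.pi) (f 0) := by
      have : (p 1 - S.center 1 / 3) ^ 2 ≤ (S.radius * (1 - 4 * s) / 3) ^ 2 := by
        rw [← hp]; linarith [sq_nonneg (p 0)]
      have := abs_le_of_sq_le_sq' this hρ
      rw [hf0, hfπ]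
      constructor <;> linarith
    obtain ⟨θ, -, hθ⟩ := intermediate_value_Icc' Real.pi_pos.le hcont.continuousOn hp1
    obtain ⟨T, hT, t0, t1, t2⟩ := h.exists_mem_family ha hb hk hs ho (hsc θ) hr
    have hc1 : T.centroid 1 = p 1 := by
      rw [centroid_apply, t0, t1, t2, ← hθ]
      rfl
    have hc := h.centroid_mem ha hb hT
    rw [hc1, ← hp] at hc
    have hc0 : T.centroid 0 ^ 2 = p 0 ^ 2 := by linarith
    rcases sq_eq_sq_iff_eq_or_eq_neg.1 hc0 with hc0 | hc0
    · exact ⟨T, hT, plane_ext hc0 hc1⟩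
    -- Replacing `sin θ` by its negative reflects the triangle in the minor axis, exchanging the
    -- roles of vertices `1` and `2`.
    · obtain ⟨T', hT', t0', t1', t2'⟩ := h.exists_mem_family ha hb hk hs ho
        (x := -Real.sin θ) (y := Real.cos θ) (by rw [neg_sq]; exact hsc θ) hr
      have d0 : ∀ x y, diskMap (S.center 1) S.radius k x y 0 =
        S.radius * (√(1 - k ^ 2) * x / (1 + k * y)) := fun _ _ => rfl
      have d1 : ∀ x y, diskMap (S.center 1) S.radius k x y 1 =
        S.center 1 + S.radius * ((y + k) / (1 + k * y)) := fun _ _ => rfl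
      refine ⟨T', hT', plane_ext ?_ ?_⟩
      · show T'.centroid 0 = p 0
        rw [← neg_eq_iff_eq_neg] at hc0
        rw [← hc0, centroid_apply, centroid_apply, t0, t1, t2, t0', t1', t2']
        simp only [d0, mul_neg, sub_neg_eq_add, ← sub_eq_add_neg]
        ring
      · show T'.centroid 1 = p 1
        rw [← hc1, centroid_apply, centroid_apply, t0, t1, t2, t0', t1', t2']
        simp only [d1, mul_neg, sub_neg_eq_add, ← sub_eq_add_neg]
        ring

/-! ### The Brocard angle and the center `X11171`. -/

theorem inner_eq_coords (x y : Plane) : inner ℝ x y = x 0 * y 0 + x 1 * y 1 := by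
  simp [PiLp.inner_apply, Fin.sum_univ_two]
  ring

theorem cos_angle_mul_dist (P Q R : Plane) :
    Real.cos (∠ P Q R) * (dist P Q * dist R Q) =
      (P 0 - Q 0) * (R 0 - Q 0) + (P 1 - Q 1) * (R 1 - Q 1) := by
  have := InnerProductGeometry.cos_angle_mul_norm_mul_norm (P -ᵥ Q) (R -ᵥ Q)
  rw [inner_eq_coords] at this
  rw [EuclideanGeometry.angle, dist_eq_norm_vsub Plane P Q, dist_eq_norm_vsub Plane R Q, this]
  rfl

theorem sin_angle_mul_dist (P Q R : Plane) :
    Real.sin (∠ P Q R) * (dist P Q * dist R Q) = |crossAt Q P R| := by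
  have := InnerProductGeometry.sin_angle_mul_norm_mul_norm (P -ᵥ Q) (R -ᵥ Q)
  simp only [inner_eq_coords] at this
  rw [EuclideanGeometry.angle, dist_eq_norm_vsub Plane P Q, dist_eq_norm_vsub Plane R Q, this,
    ← Real.sqrt_sq_eq_abs]
  congr 1
  simp only [vsub_eq_sub, PiLp.sub_apply, crossAt]
  ring

theorem mem_interior_iff (T : Tri) (X : Plane) :
    X ∈ T.interior ↔ ∃ w0 w1 w2 : ℝ, 0 < w0 ∧ 0 < w1 ∧ 0 < w2 ∧ w0 + w1 + w2 = 1 ∧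
      ∀ j, X j = w0 * T.points 0 j + w1 * T.points 1 j + w2 * T.points 2 j := by
  constructor
  · rintro ⟨w, hw, hpos, rfl⟩
    refine ⟨w 0, w 1, w 2, (hpos 0).1, (hpos 1).1, (hpos 2).1, ?_, fun j => ?_⟩
    · rw [← hw, Fin.sum_univ_three]
    · rw [Finset.affineCombination_eq_linear_combination _ _ _ hw]
      simp [Fin.sum_univ_three]
  · rintro ⟨w0, w1, w2, h0, h1, h2, hs, hX⟩
    have hw : ∑ i, ![w0, w1, w2] i = 1 := by simpa [Fin.sum_univ_three] using hs
    refine ⟨![w0, w1, w2], hw, ?_, ?_⟩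
    · intro i
      fin_cases i
      · exact ⟨h0, show w0 < 1 by linarith⟩
      · exact ⟨h1, show w1 < 1 by linarith⟩
      · exact ⟨h2, show w2 < 1 by linarith⟩
    · rw [Finset.affineCombination_eq_linear_combination _ _ _ hw]
      ext j
      rw [hX j]
      simp [Fin.sum_univ_three]

/-- The double areas of the triangles formed by the sides of `T` and a point with positive
barycentric coordinates. -/
theorem abs_crossAt_interior {T : Tri} {X : Plane} {w0 w1 w2 : ℝ} (h0 : 0 < w0) (h1 : 0 < w1)
    (h2 : 0 < w2) (hs : w0 + w1 + w2 = 1)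
    (hX : ∀ j, X j = w0 * T.points 0 j + w1 * T.points 1 j + w2 * T.points 2 j) :
    |crossAt (T.points 0) X (T.points 1)| = w2 * |doubleArea T| ∧
    |crossAt (T.points 1) X (T.points 2)| = w0 * |doubleArea T| ∧
    |crossAt (T.points 2) X (T.points 0)| = w1 * |doubleArea T| := by
  have e0 : w0 = 1 - w1 - w2 := by linarith
  refine ⟨?_, ?_, ?_⟩
  · rw [← abs_of_pos h2, ← abs_mul, ← abs_neg]
    congr 1
    unfold doubleArea crossAt
    rw [hX, hX, e0]
    ring
  · rw [← abs_of_pos h0, ← abs_mul, ← abs_neg]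
    congr 1
    unfold doubleArea crossAt
    rw [hX, hX, e0]
    ring
  · rw [← abs_of_pos h1, ← abs_mul, ← abs_neg]
    congr 1
    unfold doubleArea crossAt
    rw [hX, hX, e0]
    ring

/-- The tangent of the Brocard angle. -/
theorem IsBrocardAngle.sideSqSum_mul_sin {T : Tri} {ω : ℝ} (h : IsBrocardAngle T ω) :
    sideSqSum T * Real.sin ω = 2 * |doubleArea T| * Real.cos ω := by
  obtain ⟨X, hX, hang⟩ := h
  obtain ⟨w0, w1, w2, h0, h1, h2, hs, hXc⟩ := (mem_interior_iff T X).1 hX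
  obtain ⟨c0, c1, c2⟩ := abs_crossAt_interior h0 h1 h2 hs hXc
  have a0 : ∠ X (T.points 0) (T.points 1) = ω := hang 0
  have a1 : ∠ X (T.points 1) (T.points 2) = ω := hang 1
  have a2 : ∠ X (T.points 2) (T.points 0) = ω := hang 2
  have s0 := sin_angle_mul_dist X (T.points 0) (T.points 1)
  have s1 := sin_angle_mul_dist X (T.points 1) (T.points 2)
  have s2 := sin_angle_mul_dist X (T.points 2) (T.points 0)
  have k0 := cos_angle_mul_dist X (T.points 0) (T.points 1)
  have k1 := cos_angle_mul_dist X (T.points 1) (T.points 2)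
  have k2 := cos_angle_mul_dist X (T.points 2) (T.points 0)
  rw [a0] at s0 k0
  rw [a1] at s1 k1
  rw [a2] at s2 k2
  rw [c0] at s0
  rw [c1] at s1
  rw [c2] at s2
  unfold sideSqSum
  rw [sideLength_zero_sq, sideLength_one_sq, sideLength_two_sq]
  -- Summed over the vertices, the dot products lose their dependence on `X` and give half of
  -- `sideSqSum T`, while the areas add up to `|doubleArea T|`.
  linear_combination 2 * Real.cos ω * (s0 + s1 + s2) - 2 * Real.sin ω * (k0 + k1 + k2)
    + 2 * Real.cos ω * |doubleArea T| * hs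

/-- Squaring and Heron's formula eliminate the area; this identifies `1 - s` with `cos² ω`. -/
theorem cos_sq_of_tan {T : Tri} {ω : ℝ}
    (h : sideSqSum T * Real.sin ω = 2 * |doubleArea T| * Real.cos ω) :
    sideSqSum T ^ 2 = 4 * Real.cos ω ^ 2 * sideSqPairSum T := by
  have hher := four_mul_doubleArea_sq T
  have h2 := congrArg (· ^ 2) h
  simp only [mul_pow, sq_abs] at h2
  have hsc := Real.sin_sq_add_cos_sq ω
  linear_combination h2 - sideSqSum T ^ 2 * hsc + Real.cos ω ^ 2 * hher

/-- The Brocard point is given by explicit barycentric weights, products of two squared sides. At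
each vertex the angle has tangent `2 |doubleArea T| / sideSqSum T` and nonnegative cosine, so all
three equal the same `arccos`. -/
theorem exists_isBrocardAngle (T : Tri) : ∃ ω, IsBrocardAngle T ω := by
  have hq := sideSqPairSum_pos T
  have hσ := sideSqSum_pos T
  have hδ : 0 < |doubleArea T| := abs_pos.2 (doubleArea_ne_zero T)
  have hl := sideLength_pos T
  have l0 := pow_pos (hl 0) 2
  have l1 := pow_pos (hl 1) 2
  have l2 := pow_pos (hl 2) 2
  obtain ⟨w0, hw0⟩ : ∃ w, w = sideLength T 2 ^ 2 * sideLength T 0 ^ 2 / sideSqPairSum T := ⟨_, rfl⟩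
  obtain ⟨w1, hw1⟩ : ∃ w, w = sideLength T 0 ^ 2 * sideLength T 1 ^ 2 / sideSqPairSum T := ⟨_, rfl⟩
  obtain ⟨w2, hw2⟩ : ∃ w, w = sideLength T 1 ^ 2 * sideLength T 2 ^ 2 / sideSqPairSum T := ⟨_, rfl⟩
  have p0 : 0 < w0 := by rw [hw0]; positivity
  have p1 : 0 < w1 := by rw [hw1]; positivity
  have p2 : 0 < w2 := by rw [hw2]; positivity
  have hs : w0 + w1 + w2 = 1 := by
    rw [hw0, hw1, hw2, ← add_div, ← add_div, div_eq_one_iff_eq hq.ne']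
    unfold sideSqPairSum
    ring
  have r0 : w2 * sideLength T 0 ^ 2 = w1 * sideLength T 2 ^ 2 := by rw [hw1, hw2]; ring
  have r1 : w0 * sideLength T 1 ^ 2 = w2 * sideLength T 0 ^ 2 := by rw [hw0, hw2]; ring
  have r2 : w1 * sideLength T 2 ^ 2 = w0 * sideLength T 1 ^ 2 := by rw [hw0, hw1]; ring
  let X : Plane := w0 • T.points 0 + w1 • T.points 1 + w2 • T.points 2
  have hX : ∀ j, X j = w0 * T.points 0 j + w1 * T.points 1 j + w2 * T.points 2 j := by
    intro j
    simp [X]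
  obtain ⟨c0, c1, c2⟩ := abs_crossAt_interior p0 p1 p2 hs hX
  have key : ∀ (P Q : Plane) (w : ℝ), 0 < w → |crossAt P X Q| = w * |doubleArea T| →
      (X 0 - P 0) * (Q 0 - P 0) + (X 1 - P 1) * (Q 1 - P 1) = w * sideSqSum T / 2 →
      ∠ X P Q = Real.arccos (√(sideSqSum T ^ 2 / (4 * sideSqPairSum T))) := by
    intro P Q w hw hc hi
    have e1 := sin_angle_mul_dist X P Q
    have e2 := cos_angle_mul_dist X P Q
    rw [hc] at e1
    rw [hi] at e2
    have hn : dist X P * dist Q P ≠ 0 := by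
      intro h0
      rw [h0, mul_zero] at e1
      have : 0 < w * |doubleArea T| := mul_pos hw hδ
      linarith
    have ht : sideSqSum T * Real.sin (∠ X P Q) = 2 * |doubleArea T| * Real.cos (∠ X P Q) := by
      apply mul_right_cancel₀ hn
      linear_combination sideSqSum T * e1 - 2 * |doubleArea T| * e2
    have hsq := cos_sq_of_tan ht
    have hcos : 0 ≤ Real.cos (∠ X P Q) := by
      have hsin := InnerProductGeometry.sin_angle_nonneg (X -ᵥ P) (Q -ᵥ P)
      have : 0 ≤ 2 * |doubleArea T| * Real.cos (∠ X P Q) := ht ▸ mul_nonneg hσ.le hsin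
      exact nonneg_of_mul_nonneg_right this (by positivity)
    have : sideSqSum T ^ 2 / (4 * sideSqPairSum T) = Real.cos (∠ X P Q) ^ 2 := by
      rw [hsq]; field_simp
    rw [this, Real.sqrt_sq hcos, Real.arccos_cos (EuclideanGeometry.angle_nonneg _ _ _)
      (EuclideanGeometry.angle_le_pi _ _ _)]
  have hσ' : sideSqSum T = sideLength T 0 ^ 2 + sideLength T 1 ^ 2 + sideLength T 2 ^ 2 := rfl
  have q0 := sideLength_zero_sq T
  have q1 := sideLength_one_sq T
  have q2 := sideLength_two_sq T
  have e0 : w0 = 1 - w1 - w2 := by linarith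
  refine ⟨Real.arccos (√(sideSqSum T ^ 2 / (4 * sideSqPairSum T))), X,
    (mem_interior_iff T X).2 ⟨w0, w1, w2, p0, p1, p2, hs, hX⟩, fun i => ?_⟩
  fin_cases i
  · refine key (T.points 0) (T.points 1) w2 p2 c0 ?_
    have : w2 * sideSqSum T / 2 = w1 * sideLength T 2 ^ 2
        + w2 * (sideLength T 1 ^ 2 + sideLength T 2 ^ 2 - sideLength T 0 ^ 2) / 2 := by
      rw [hσ']; linear_combination r0
    rw [this, q0, q1, q2, hX, hX, e0]
    ring
  · refine key (T.points 1) (T.points 2) w0 p0 c1 ?_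
    have : w0 * sideSqSum T / 2 = w2 * sideLength T 0 ^ 2
        + w0 * (sideLength T 2 ^ 2 + sideLength T 0 ^ 2 - sideLength T 1 ^ 2) / 2 := by
      rw [hσ']; linear_combination r1
    rw [this, q0, q1, q2, hX, hX, e0]
    ring
  · refine key (T.points 2) (T.points 0) w1 p1 c2 ?_
    have : w1 * sideSqSum T / 2 = w0 * sideLength T 1 ^ 2
        + w1 * (sideLength T 0 ^ 2 + sideLength T 1 ^ 2 - sideLength T 2 ^ 2) / 2 := by
      rw [hσ']; linear_combination r2
    rw [this, q0, q1, q2, hX, hX, e0]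
    ring

theorem cos_vertexAngle (T : Tri) :
    Real.cos (vertexAngle T 0) * (sideLength T 1 * sideLength T 2) =
      (sideSqSum T - 2 * sideLength T 0 ^ 2) / 2 ∧
    Real.cos (vertexAngle T 1) * (sideLength T 2 * sideLength T 0) =
      (sideSqSum T - 2 * sideLength T 1 ^ 2) / 2 ∧
    Real.cos (vertexAngle T 2) * (sideLength T 0 * sideLength T 1) =
      (sideSqSum T - 2 * sideLength T 2 ^ 2) / 2 := by
  have h0 := cos_angle_mul_dist (T.points 1) (T.points 0) (T.points 2)
  have h1 := cos_angle_mul_dist (T.points 2) (T.points 1) (T.points 0)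
  have h2 := cos_angle_mul_dist (T.points 0) (T.points 2) (T.points 1)
  have d0 : dist (T.points 1) (T.points 2) = sideLength T 0 := rfl
  have d1 : dist (T.points 2) (T.points 0) = sideLength T 1 := rfl
  have d2 : dist (T.points 0) (T.points 1) = sideLength T 2 := rfl
  have v0 : ∠ (T.points 1) (T.points 0) (T.points 2) = vertexAngle T 0 := rfl
  have v1 : ∠ (T.points 2) (T.points 1) (T.points 0) = vertexAngle T 1 := rfl
  have v2 : ∠ (T.points 0) (T.points 2) (T.points 1) = vertexAngle T 2 := rfl
  rw [v0, dist_comm (T.points 1), d1, d2] at h0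
  rw [v1, dist_comm (T.points 2), d0, d2] at h1
  rw [v2, dist_comm (T.points 0), d0, d1] at h2
  unfold sideSqSum
  rw [sideLength_zero_sq, sideLength_one_sq, sideLength_two_sq]
  refine ⟨?_, ?_, ?_⟩
  · linear_combination h0
  · linear_combination h1
  · linear_combination h2

theorem sin_vertexAngle (T : Tri) :
    Real.sin (vertexAngle T 0) * (sideLength T 1 * sideLength T 2) = |doubleArea T| ∧
    Real.sin (vertexAngle T 1) * (sideLength T 2 * sideLength T 0) = |doubleArea T| ∧
    Real.sin (vertexAngle T 2) * (sideLength T 0 * sideLength T 1) = |doubleArea T| := by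
  have h0 := sin_angle_mul_dist (T.points 1) (T.points 0) (T.points 2)
  have h1 := sin_angle_mul_dist (T.points 2) (T.points 1) (T.points 0)
  have h2 := sin_angle_mul_dist (T.points 0) (T.points 2) (T.points 1)
  have d0 : dist (T.points 1) (T.points 2) = sideLength T 0 := rfl
  have d1 : dist (T.points 2) (T.points 0) = sideLength T 1 := rfl
  have d2 : dist (T.points 0) (T.points 1) = sideLength T 2 := rfl
  have v0 : ∠ (T.points 1) (T.points 0) (T.points 2) = vertexAngle T 0 := rfl
  have v1 : ∠ (T.points 2) (T.points 1) (T.points 0) = vertexAngle T 1 := rfl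
  have v2 : ∠ (T.points 0) (T.points 2) (T.points 1) = vertexAngle T 2 := rfl
  have c0 : crossAt (T.points 0) (T.points 1) (T.points 2) = doubleArea T := rfl
  have c1 : crossAt (T.points 1) (T.points 2) (T.points 0) = doubleArea T := by
    unfold doubleArea crossAt; ring
  have c2 : crossAt (T.points 2) (T.points 0) (T.points 1) = doubleArea T := by
    unfold doubleArea crossAt; ring
  rw [v0, dist_comm (T.points 1), d1, d2, c0] at h0
  rw [v1, dist_comm (T.points 2), d0, d2, c1] at h1
  rw [v2, dist_comm (T.points 0), d0, d1, c2] at h2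
  refine ⟨?_, ?_, ?_⟩
  · linear_combination h0
  · linear_combination h1
  · linear_combination h2

/-- The center `X11171` divides the segment from the circumcenter to the symmedian point in a
ratio that depends only on the Brocard angle. -/
theorem X11171_apply {T : Tri} {S : EuclideanGeometry.Sphere Plane} (hS : T.circumsphere = S)
    {ω : ℝ} (h : IsBrocardAngle T ω) (j : Fin 2) :
    X11171 T ω j = S.center j + 2 / 3 * Real.cos ω ^ 2 * (X6 T j - S.center j) := by
  have ht := h.sideSqSum_mul_sin
  have hδ := doubleArea_ne_zero T
  have hl := sideLength_pos T
  obtain ⟨c0, c1, c2⟩ := cos_vertexAngle T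
  obtain ⟨s0, s1, s2⟩ := sin_vertexAngle T
  -- Here `π` is the product of the side lengths, used to clear denominators in the trilinears.
  obtain ⟨π, hπ⟩ : ∃ π, π = sideLength T 0 * sideLength T 1 * sideLength T 2 := ⟨_, rfl⟩
  have hπ0 : 0 < π := by
    rw [hπ]; exact mul_pos (mul_pos (hl 0) (hl 1)) (hl 2)
  have hO := doubleArea_sq_mul_center hS j
  have hK := sideSqSum_mul_X6 T j
  have hher := four_mul_doubleArea_sq T
  -- By the addition formula, each weight is a combination of the circumcenter's weight and the
  -- symmedian point's weight, with coefficients common to all vertices.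
  have hw : ∀ l φ m : ℝ, π = l * m →
      Real.cos φ * m = (sideSqSum T - 2 * l ^ 2) / 2 → Real.sin φ * m = |doubleArea T| →
      π * ((2 * Real.cos φ - Real.cos (φ + 2 * ω)) * l) =
        (2 - Real.cos (2 * ω)) / 2 * (l ^ 2 * (sideSqSum T - 2 * l ^ 2))
          + Real.sin (2 * ω) * |doubleArea T| * l ^ 2 := by
    intro l φ m hm hc hs
    rw [Real.cos_add, hm]
    linear_combination l ^ 2 * (2 - Real.cos (2 * ω)) * hc + l ^ 2 * Real.sin (2 * ω) * hs
  have g0 := hw _ _ _ (by rw [hπ]; ring) c0 s0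
  have g1 := hw _ _ _ (by rw [hπ]; ring) c1 s1
  have g2 := hw _ _ _ (by rw [hπ]; ring) c2 s2
  rw [X11171, ofTrilinears_apply]
  set W0 := (2 * Real.cos (vertexAngle T 0) - Real.cos (vertexAngle T 0 + 2 * ω)) * sideLength T 0
  set W1 := (2 * Real.cos (vertexAngle T 1) - Real.cos (vertexAngle T 1 + 2 * ω)) * sideLength T 1
  set W2 := (2 * Real.cos (vertexAngle T 2) - Real.cos (vertexAngle T 2 + 2 * ω)) * sideLength T 2
  have habs : |doubleArea T| * |doubleArea T| = doubleArea T ^ 2 := by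
    rw [← pow_two, sq_abs]
  have hsin2 : sideSqSum T * |doubleArea T| * Real.sin (2 * ω)
      = 4 * doubleArea T ^ 2 * Real.cos ω ^ 2 := by
    rw [Real.sin_two_mul]
    linear_combination 2 * Real.cos ω * |doubleArea T| * ht + 4 * Real.cos ω ^ 2 * habs
  have hsum : π * (W0 + W1 + W2) = 6 * doubleArea T ^ 2 := by
    have e : sideLength T 0 ^ 2 * (sideSqSum T - 2 * sideLength T 0 ^ 2)
        + sideLength T 1 ^ 2 * (sideSqSum T - 2 * sideLength T 1 ^ 2)
        + sideLength T 2 ^ 2 * (sideSqSum T - 2 * sideLength T 2 ^ 2) = 4 * doubleArea T ^ 2 := by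
      rw [hher]; unfold sideSqSum sideSqPairSum; ring
    have e' : sideSqSum T = sideLength T 0 ^ 2 + sideLength T 1 ^ 2 + sideLength T 2 ^ 2 := rfl
    have hc2 := Real.cos_two_mul ω
    linear_combination g0 + g1 + g2 + (2 - Real.cos (2 * ω)) / 2 * e + hsin2
      - Real.sin (2 * ω) * |doubleArea T| * e' - 2 * doubleArea T ^ 2 * hc2
  have hpt : π * (W0 * T.points 0 j + W1 * T.points 1 j + W2 * T.points 2 j) =
      6 * doubleArea T ^ 2 *
        (S.center j + 2 / 3 * Real.cos ω ^ 2 * (X6 T j - S.center j)) := by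
    have hc2 := Real.cos_two_mul ω
    linear_combination T.points 0 j * g0 + T.points 1 j * g1 + T.points 2 j * g2
      - (2 - Real.cos (2 * ω)) / 2 * hO - Real.sin (2 * ω) * |doubleArea T| * hK
      + X6 T j * hsin2 - 2 * doubleArea T ^ 2 * S.center j * hc2
  have hW : W0 + W1 + W2 = 6 * doubleArea T ^ 2 / π := by
    rw [← hsum]; field_simp
  have hWP : W0 * T.points 0 j + W1 * T.points 1 j + W2 * T.points 2 j =
      6 * doubleArea T ^ 2 / π *
        (S.center j + 2 / 3 * Real.cos ω ^ 2 * (X6 T j - S.center j)) := by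
    rw [div_mul_eq_mul_div, ← hpt]; field_simp
  rw [hW, hWP, inv_mul_cancel_left₀ (div_ne_zero (by positivity) hπ0.ne')]

/-! ### Transport by isometries. -/

/-- The image of a triangle under an isometry of the plane. -/
noncomputable def mapTri (f : Plane ≃ᵃⁱ[ℝ] Plane) (T : Tri) : Tri :=
  T.map (f.toAffineEquiv : Plane →ᵃ[ℝ] Plane) f.injective

/-- The image of a circle under an isometry of the plane. -/
noncomputable def mapSphere (f : Plane ≃ᵃⁱ[ℝ] Plane) (S : EuclideanGeometry.Sphere Plane) :
    EuclideanGeometry.Sphere Plane :=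
  ⟨f S.center, S.radius⟩

section

variable (f : Plane ≃ᵃⁱ[ℝ] Plane)

theorem mapTri_points (T : Tri) (i : Fin 3) : (mapTri f T).points i = f (T.points i) := rfl

theorem sideLength_mapTri (T : Tri) (i : Fin 3) : sideLength (mapTri f T) i = sideLength T i :=
  f.dist_map _ _

theorem mapTri_circumsphere {T : Tri} {S : EuclideanGeometry.Sphere Plane}
    (h : T.circumsphere = S) : (mapTri f T).circumsphere = mapSphere f S := by
  rw [circumsphere_eq_iff] at h ⊢
  intro i
  rw [mapTri_points]
  exact (f.dist_map _ _).trans (h i)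

theorem centroid_mapTri (T : Tri) : (mapTri f T).centroid = f T.centroid :=
  T.centroid_map _ _

theorem apply_eq_linear_add (x : Plane) : f x = f.linearIsometryEquiv x + f 0 := by
  have := f.map_vadd 0 x
  simpa using this

theorem ofTrilinears_mapTri (T : Tri) (p : Fin 3 → ℝ) (hp : ∑ i, p i * sideLength T i ≠ 0) :
    ofTrilinears (mapTri f T) p = f (ofTrilinears T p) := by
  rw [apply_eq_linear_add f (ofTrilinears T p)]
  simp only [ofTrilinears, sideLength_mapTri, mapTri_points]
  simp_rw [apply_eq_linear_add f (T.points _), smul_add, Finset.sum_add_distrib, ← Finset.sum_smul,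
    smul_add, inv_smul_smul₀ hp, map_smul, map_sum, map_smul]

theorem X6_mapTri (T : Tri) : X6 (mapTri f T) = f (X6 T) := by
  have h : sideLength (mapTri f T) = sideLength T := funext (sideLength_mapTri f T)
  rw [X6, h, ofTrilinears_mapTri, X6]
  have := sideSqSum_pos T
  rw [Fin.sum_univ_three]
  unfold sideSqSum at this
  simp only [pow_two] at this
  exact this.ne'

theorem X39_mapTri (T : Tri) : X39 (mapTri f T) = f (X39 T) := by
  have h : sideLength (mapTri f T) = sideLength T := funext (sideLength_mapTri f T)
  rw [X39, h, ofTrilinears_mapTri, X39]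
  have hl := sideLength_pos T
  refine (Finset.sum_pos (fun i _ => ?_) Finset.univ_nonempty).ne'
  have h0 := hl i
  have h1 := hl (i + 1)
  have h2 := hl (i + 2)
  positivity

theorem line_map (P Q : Plane) :
    (line[ℝ, f P, f Q] : Set Plane) = f '' (line[ℝ, P, Q] : Set Plane) := by
  have hl : ∀ r : ℝ, f (AffineMap.lineMap P Q r) = AffineMap.lineMap (f P) (f Q) r := fun r =>
    AffineMap.apply_lineMap (f.toAffineEquiv : Plane →ᵃ[ℝ] Plane) P Q r
  ext X
  simp only [Set.mem_image, SetLike.mem_coe, mem_affineSpan_pair_iff_exists_lineMap_eq]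
  constructor
  · rintro ⟨r, rfl⟩
    exact ⟨_, ⟨r, rfl⟩, hl r⟩
  · rintro ⟨_, ⟨r, rfl⟩, rfl⟩
    exact ⟨r, (hl r).symm⟩

theorem sideLine_mapTri_inter {T : Tri} {E : Set Plane} {i : Fin 3} {D : Plane}
    (h : (sideLine T i : Set Plane) ∩ E = {D}) :
    (sideLine (mapTri f T) i : Set Plane) ∩ f '' E = {f D} := by
  have : (sideLine (mapTri f T) i : Set Plane) = f '' (sideLine T i : Set Plane) :=
    line_map f _ _
  rw [this, ← Set.image_inter f.injective, h, Set.image_singleton]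

theorem mapTri_mem_family {S : EuclideanGeometry.Sphere Plane} {E : Set Plane} {T : Tri}
    (h : T ∈ family S E) : mapTri f T ∈ family (mapSphere f S) (f '' E) := by
  refine ⟨mapTri_circumsphere f h.1, fun i => ?_⟩
  obtain ⟨D, hD⟩ := h.2 i
  exact ⟨f D, sideLine_mapTri_inter f hD⟩

theorem isEllipseAt_image {E : Set Plane} {o : Plane} (h : IsEllipseAt E o) :
    IsEllipseAt (f '' E) (f o) := by
  obtain ⟨a, b, hb, hab, g, hg, rfl⟩ := h
  refine ⟨a, b, hb, hab, g.trans f, ?_, ?_⟩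
  · rw [AffineIsometryEquiv.coe_trans, Function.comp_apply, hg]
  · rw [AffineIsometryEquiv.coe_trans, Set.image_comp]

theorem isBrocardPair_image {S : EuclideanGeometry.Sphere Plane} {E : Set Plane}
    (h : IsBrocardPair S E) : IsBrocardPair (mapSphere f S) (f '' E) := by
  obtain ⟨T, hS, hE, hD⟩ := h
  refine ⟨mapTri f T, mapTri_circumsphere f hS, ?_, fun i => ?_⟩
  · rw [X39_mapTri]
    exact isEllipseAt_image f hE
  · obtain ⟨D, hDl, hDs⟩ := hD i
    refine ⟨f D, ?_, sideLine_mapTri_inter f hDs⟩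
    rw [X6_mapTri, mapTri_points, ← SetLike.mem_coe, line_map]
    exact ⟨D, hDl, rfl⟩

theorem image_locusX2_subset (S : EuclideanGeometry.Sphere Plane) (E : Set Plane) :
    f '' locusX2 S E ⊆ locusX2 (mapSphere f S) (f '' E) := by
  rintro _ ⟨_, ⟨T, hT, rfl⟩, rfl⟩
  exact ⟨mapTri f T, mapTri_mem_family f hT, centroid_mapTri f T⟩

theorem mem_locusX2_iff (S : EuclideanGeometry.Sphere Plane) (E : Set Plane) (p : Plane) :
    p ∈ locusX2 S E ↔ f p ∈ locusX2 (mapSphere f S) (f '' E) := by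
  constructor
  · intro h
    exact image_locusX2_subset f S E ⟨p, h, rfl⟩
  · intro h
    have := image_locusX2_subset f.symm _ _ ⟨f p, h, rfl⟩
    rw [f.symm_apply_apply, ← Set.image_comp] at this
    have hid : (f.symm ∘ f : Plane → Plane) = id := funext f.symm_apply_apply
    have hS : mapSphere f.symm (mapSphere f S) = S := by
      simp [mapSphere]
    rwa [hid, Set.image_id, hS] at this

end

/-- The locus of the centroid over a Brocard porism, in terms of any triangle of the porism. -/
theorem locusX2_eq_sphere {S : EuclideanGeometry.Sphere Plane} {E : Set Plane}
    (h : IsBrocardPair S E) {T : Tri} (hT : T ∈ family S E) {ω : ℝ} (hω : IsBrocardAngle T ω) :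
    0 ≤ S.radius * (2 * Real.cos (2 * ω) - 1) / 3 ∧
      locusX2 S E = Metric.sphere (X11171 T ω) (S.radius * (2 * Real.cos (2 * ω) - 1) / 3) := by
  obtain ⟨a, b, hb, hab, g, hg⟩ : ∃ a b : ℝ, 0 < b ∧ b ≤ a ∧
      ∃ g : Plane ≃ᵃⁱ[ℝ] Plane, E = g '' stdEllipse a b := by
    obtain ⟨_, _, ⟨a, b, hb, hab, g, -, hg⟩, -⟩ := h
    exact ⟨a, b, hb, hab, g, hg⟩
  have ha : 0 < a := hb.trans_le hab
  have hE : g.symm '' E = stdEllipse a b := by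
    have hid : (g.symm ∘ g : Plane → Plane) = id := funext g.symm_apply_apply
    rw [hg, ← Set.image_comp, hid, Set.image_id]
  have h' := isBrocardPair_image g.symm h
  have hT' := mapTri_mem_family g.symm hT
  have hloc := mem_locusX2_iff g.symm S E
  rw [hE] at h' hT' hloc
  obtain ⟨s, hs⟩ := IsBrocardPair.exists_isStdPair hb hab h'
  obtain ⟨e0, e1, e2⟩ := hs.X6_of_mem_family ha hb hT'
  have hsum : sideSqSum (mapTri g.symm T) = sideSqSum T := by
    unfold sideSqSum; simp only [sideLength_mapTri]
  have hpair : sideSqPairSum (mapTri g.symm T) = sideSqPairSum T := by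
    unfold sideSqPairSum; simp only [sideLength_mapTri]
  rw [hsum, hpair, cos_sq_of_tan hω.sideSqSum_mul_sin] at e2
  have hcos : Real.cos ω ^ 2 = 1 - s := by
    apply mul_right_cancel₀ (sideSqPairSum_pos T).ne'
    linear_combination e2 / 4
  -- `2 cos 2ω - 1 = 4 cos² ω - 3 = 1 - 4 s`.
  have hr : S.radius * (2 * Real.cos (2 * ω) - 1) / 3 = S.radius * (1 - 4 * s) / 3 := by
    rw [Real.cos_two_mul]
    linear_combination 4 / 3 * S.radius * hcos
  have hX : X11171 T ω = AffineMap.lineMap S.center (X6 T) (2 / 3 * (1 - s)) := by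
    ext j
    rw [X11171_apply hT.1 hω, hcos]
    simp [AffineMap.lineMap_apply]
    ring
  have hfX : g.symm (X11171 T ω) = !₂[0, (mapSphere g.symm S).center 1 / 3] := by
    have hl : g.symm (AffineMap.lineMap S.center (X6 T) (2 / 3 * (1 - s))) =
        AffineMap.lineMap (mapSphere g.symm S).center (X6 (mapTri g.symm T)) (2 / 3 * (1 - s)) := by
      rw [X6_mapTri]
      exact AffineMap.apply_lineMap (g.symm.toAffineEquiv : Plane →ᵃ[ℝ] Plane) _ _ _
    rw [hX, hl]
    apply plane_ext
    · simp [AffineMap.lineMap_apply, e0, hs.center_zero]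
    · simp only [AffineMap.lineMap_apply, vsub_eq_sub, vadd_eq_add, PiLp.add_apply, PiLp.smul_apply,
        PiLp.sub_apply, smul_eq_mul, Matrix.cons_val_one, Matrix.cons_val_fin_one]
      linear_combination 2 / 3 * e1
  rw [hr]
  refine ⟨?_, ?_⟩
  · have := hs.one_sub_four_mul_nonneg
    have hR : 0 < S.radius := hs.radius_pos
    positivity
  · ext p
    rw [hloc, hs.locusX2_eq ha hb, ← hfX, Metric.mem_sphere, Metric.mem_sphere, g.symm.dist_map]
    rfl

/-! ### The isosceles model and explicit formulas in `a` and `b`. -/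

/-- The foot of the cevian through the symmedian point divides a side in the ratio of the squares
of the adjacent sides. -/
theorem cevian_foot_mem {T : Tri} {w0 w1 w2 : ℝ} {P0 P1 P2 D : Plane} (h1 : 0 < w1) (h2 : 0 < w2)
    (hσ : w0 + w1 + w2 = sideSqSum T)
    (hK : ∀ j, sideSqSum T * X6 T j = w0 * P0 j + w1 * P1 j + w2 * P2 j)
    (hD : ∀ j, (w1 + w2) * D j = w1 * P1 j + w2 * P2 j) :
    D ∈ line[ℝ, P0, X6 T] ∧ D ∈ line[ℝ, P1, P2] := by
  have h12 : w1 + w2 ≠ 0 := by positivity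
  constructor
  · refine mem_line_iff.2 ⟨sideSqSum T / (w1 + w2), ?_, ?_⟩
    · field_simp
      linear_combination hD 0 - hK 0 - P0 0 * hσ
    · field_simp
      linear_combination hD 1 - hK 1 - P0 1 * hσ
  · refine mem_line_iff.2 ⟨w2 / (w1 + w2), ?_, ?_⟩
    · field_simp
      linear_combination hD 0
    · field_simp
      linear_combination hD 1

/-- An isosceles triangle with apex `(0, u - b)` and base on the line `y = -b`, inscribed in a
circle of radius `(u + v) / 2`, whose Brocard inellipse is in standard position. -/
theorem isBrocardPair_isosceles {a b u v : ℝ} (hb : 0 < b) (hab : b ≤ a) (hu : 0 < u) (hv : 0 < v)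
    (ha2 : a ^ 2 = v * (u - 2 * b)) (hrel : 4 * (v * (u - 2 * b)) = b * (u + v)) :
    IsBrocardPair ⟨!₂[0, u - b - (u + v) / 2], (u + v) / 2⟩ (stdEllipse a b) := by
  have ha : 0 < a := hb.trans_le hab
  -- The altitude to the base cuts the vertical diameter into `u` and `v`, so the half base `w`
  -- satisfies `w² = u v`. The relation `ha2` is tangency of the legs; `hrel` puts `X39` at the
  -- origin.
  obtain ⟨w, hw, hw2⟩ : ∃ w : ℝ, 0 < w ∧ w ^ 2 = u * v :=
    ⟨√(u * v), Real.sqrt_pos.2 (by positivity), Real.sq_sqrt (by positivity)⟩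
  have hd : ∀ x y : ℝ, x ^ 2 + (y - (u - b - (u + v) / 2)) ^ 2 = ((u + v) / 2) ^ 2 →
      dist (!₂[x, y] : Plane) !₂[0, u - b - (u + v) / 2] = (u + v) / 2 := by
    intro x y hxy
    apply (sq_eq_sq₀ dist_nonneg (by positivity)).1
    rw [dist_sq_eq]
    simpa using hxy
  have hne : ∀ x y x' y' : ℝ, (!₂[x, y] : Plane) = !₂[x', y'] → x = x' := fun x y x' y' h =>
    congrArg (fun p : Plane => p 0) h
  obtain ⟨T, hS, t0, t1, t2⟩ := exists_tri_of_cospherical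
    (S := ⟨!₂[0, u - b - (u + v) / 2], (u + v) / 2⟩)
    (p0 := !₂[0, u - b]) (p1 := !₂[-w, -b]) (p2 := !₂[w, -b])
    (hd _ _ (by ring)) (hd _ _ (by linear_combination hw2)) (hd _ _ (by linear_combination hw2))
    (fun h => by have := hne _ _ _ _ h; linarith) (fun h => by have := hne _ _ _ _ h; linarith)
    (fun h => by have := hne _ _ _ _ h; linarith)
  have x0 : T.points 0 0 = 0 := by rw [t0]; rfl
  have y0 : T.points 0 1 = u - b := by rw [t0]; rfl
  have x1 : T.points 1 0 = -w := by rw [t1]; rfl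
  have y1 : T.points 1 1 = -b := by rw [t1]; rfl
  have x2 : T.points 2 0 = w := by rw [t2]; rfl
  have y2 : T.points 2 1 = -b := by rw [t2]; rfl
  have l0 : sideLength T 0 ^ 2 = 4 * (u * v) := by
    rw [sideLength_zero_sq, x1, x2, y1, y2]; linear_combination 4 * hw2
  have l1 : sideLength T 1 ^ 2 = u * (u + v) := by
    rw [sideLength_one_sq, x0, x2, y0, y2]; linear_combination hw2
  have l2 : sideLength T 2 ^ 2 = u * (u + v) := by
    rw [sideLength_two_sq, x0, x1, y0, y1]; linear_combination hw2
  have hσ : sideSqSum T = 4 * (u * v) + 2 * (u * (u + v)) := by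
    unfold sideSqSum; rw [l0, l1, l2]; ring
  have hX39 : X39 T = 0 := by
    have hq := sideSqPairSum_pos T
    have e0 := sideSqPairSum_mul_X39 T 0
    have e1 := sideSqPairSum_mul_X39 T 1
    rw [x0, x1, x2, hσ, l0, l1, l2] at e0
    rw [y0, y1, y2, hσ, l0, l1, l2] at e1
    have hq2 : 2 * sideSqPairSum T ≠ 0 := by positivity
    apply plane_ext
    · apply mul_left_cancel₀ hq2
      rw [e0]
      simp
    · apply mul_left_cancel₀ hq2
      rw [e1]
      simp only [PiLp.zero_apply, mul_zero]
      linear_combination 2 * u ^ 2 * (u + v) * hrel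
  refine ⟨T, hS, ⟨a, b, hb, hab, AffineIsometryEquiv.refl ℝ Plane, ?_, ?_⟩, ?_⟩
  · rw [hX39]; rfl
  · simp
  have hK := sideSqSum_mul_X6 T
  rw [l0, l1, l2] at hK
  have hfoot : ∀ i : Fin 3, ∀ D : Plane, D ∈ line[ℝ, T.points i, X6 T] →
      D ∈ sideLine T i → D ∈ stdEllipse a b →
      a ^ 2 * (T.points (i + 1) 1 - T.points (i + 2) 1) ^ 2
          + b ^ 2 * (T.points (i + 1) 0 - T.points (i + 2) 0) ^ 2 =
        (T.points (i + 1) 0 * T.points (i + 2) 1 - T.points (i + 1) 1 * T.points (i + 2) 0) ^ 2 →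
      ∃ D ∈ line[ℝ, T.points i, X6 T], (sideLine T i : Set Plane) ∩ stdEllipse a b = {D} := by
    intro i D h1 h2 h3 h4
    have hne : i + 1 ≠ i + 2 := (by decide : ∀ i : Fin 3, i + 1 ≠ i + 2) i
    obtain ⟨D', hD'⟩ := (line_inter_stdEllipse_eq_singleton_iff ha hb (points_ne T hne)).2 h4
    have : D ∈ (line[ℝ, T.points (i + 1), T.points (i + 2)] : Set Plane) ∩ stdEllipse a b := ⟨h2, h3⟩
    rw [hD'] at this
    have : D = D' := this
    subst this
    exact ⟨D, h1, hD'⟩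
  have huv : 0 < u * v := by positivity
  have huv' : 0 < u * (u + v) := by positivity
  have hden : 5 * v + u ≠ 0 := by positivity
  have ha0 := ha.ne'
  have hb0 := hb.ne'
  -- These are the feet of the symmedians on the two legs, which divide them in the ratio `4 u v : u
  -- (u + v)`; `hrel` simplifies the second coordinate.
  have hmem : ∀ ε : ℝ, ε ^ 2 = 1 → (!₂[ε * (w * (u + v) / (5 * v + u)), 4 * b * v / (5 * v + u)] : Plane)
      ∈ stdEllipse a b := by
    intro ε hε
    show (ε * (w * (u + v) / (5 * v + u))) ^ 2 / a ^ 2 + (4 * b * v / (5 * v + u)) ^ 2 / b ^ 2 = 1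
    rw [mul_pow, hε, div_pow, div_pow, mul_pow w, hw2]
    field_simp
    rw [ha2]
    linear_combination -2 * v * (u + v) * hrel
  intro i
  fin_cases i
  · have hf := cevian_foot_mem (T := T) (D := !₂[0, -b]) huv' huv' (by rw [hσ]; ring) hK (by
      intro j
      fin_cases j
      · simp only [Fin.zero_eta, x1, x2]
        simp
      · simp only [Fin.mk_one, y1, y2]
        simp
        ring)
    refine hfoot 0 _ hf.1 hf.2 ?_ ?_
    · show (0 : ℝ) ^ 2 / a ^ 2 + (-b) ^ 2 / b ^ 2 = 1
      simp [hb0]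
    · simp only [zero_add, x1, x2, y1, y2]
      ring
  · have hf := cevian_foot_mem (T := T) (P0 := T.points 1) (P1 := T.points 2) (P2 := T.points 0)
      (w0 := u * (u + v)) (D := !₂[1 * (w * (u + v) / (5 * v + u)), 4 * b * v / (5 * v + u)])
      huv' (mul_pos four_pos huv) (by rw [hσ]; ring) (fun j => by rw [hK j]; ring) (by
      intro j
      fin_cases j
      · simp only [Fin.zero_eta, x0, x2]
        simp
        field_simp
        ring
      · simp only [Fin.mk_one, y0, y2]
        simp
        field_simp
        linear_combination -(u + 5 * v) * hrel)
    refine hfoot 1 _ hf.1 hf.2 (hmem 1 (by norm_num)) ?_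
    · have e1 : (1 : Fin 3) + 1 = 2 := rfl
      have e2 : (1 : Fin 3) + 2 = 0 := rfl
      simp only [e1, e2, x0, x2, y0, y2]
      linear_combination u ^ 2 * ha2 + (b ^ 2 - (u - b) ^ 2) * hw2
  · have hf := cevian_foot_mem (T := T) (P0 := T.points 2) (P1 := T.points 0) (P2 := T.points 1)
      (w0 := u * (u + v)) (D := !₂[-1 * (w * (u + v) / (5 * v + u)), 4 * b * v / (5 * v + u)])
      (mul_pos four_pos huv) huv' (by rw [hσ]; ring) (fun j => by rw [hK j]; ring) (by
      intro j
      fin_cases j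
      · simp only [Fin.zero_eta, x0, x1]
        simp
        field_simp
        ring
      · simp only [Fin.mk_one, y0, y1]
        simp
        field_simp
        linear_combination -(u + 5 * v) * hrel)
    refine hfoot 2 _ hf.1 hf.2 (hmem (-1) (by norm_num)) ?_
    · have e1 : (2 : Fin 3) + 1 = 0 := rfl
      have e2 : (2 : Fin 3) + 2 = 1 := rfl
      simp only [e1, e2, x0, x1, y0, y1]
      linear_combination u ^ 2 * ha2 + (b ^ 2 - (u - b) ^ 2) * hw2

theorem discriminant_nonneg {a b : ℝ} (hb : 0 < b) (hab : b ≤ a) :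
    0 ≤ 4 * a ^ 4 - 5 * a ^ 2 * b ^ 2 + b ^ 4 := by
  have h1 : b ^ 2 ≤ a ^ 2 := pow_le_pow_left₀ hb.le hab 2
  have h2 : 0 ≤ (4 * a ^ 2 - b ^ 2) * (a ^ 2 - b ^ 2) :=
    mul_nonneg (by nlinarith [sq_nonneg a]) (by linarith)
  linarith

theorem exists_isBrocardPair_stdEllipse {a b : ℝ} (hb : 0 < b) (hab : b ≤ a) :
    ∃ S : EuclideanGeometry.Sphere Plane,
      IsBrocardPair S (stdEllipse a b) ∧ S.center 1 ≤ 0 := by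
  have ha : 0 < a := hb.trans_le hab
  -- Solving `a² = s R²` and `b = 2 s R` gives `R` and `s = b / (2 R)`; then `h² = R² (1 - s) (1 - 4
  -- s)`, and the circumcenter is `(0, -h)`.
  obtain ⟨R, hR⟩ : ∃ R, R = 2 * a ^ 2 / b := ⟨_, rfl⟩
  obtain ⟨h, hh⟩ : ∃ h, h = √(4 * a ^ 4 - 5 * a ^ 2 * b ^ 2 + b ^ 4) / b := ⟨_, rfl⟩
  have hh0 : 0 ≤ h := by rw [hh]; positivity
  have hbR : b * R = 2 * a ^ 2 := by rw [hR]; field_simp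
  have hh2 : h ^ 2 = R ^ 2 - 5 / 2 * (b * R) + b ^ 2 := by
    rw [hh, div_pow, Real.sq_sqrt (discriminant_nonneg hb hab), hbR, hR]
    field_simp
    ring
  have h2b : 2 * b ≤ R := by
    rw [hR, le_div_iff₀ hb]
    nlinarith
  have hlt : h < R := by
    apply lt_of_pow_lt_pow_left₀ 2 (by linarith)
    rw [hh2]
    nlinarith
  have key : 2 * ((R + h - b) * (R - h - b)) = b * R := by linear_combination -2 * hh2
  refine ⟨⟨!₂[0, (R - h + b) - b - ((R - h + b) + (R + h - b)) / 2],
    ((R - h + b) + (R + h - b)) / 2⟩, ?_, ?_⟩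
  · exact isBrocardPair_isosceles hb hab (by linarith) (by linarith)
      (by linear_combination -key / 2 - hbR / 2) (by linear_combination 2 * key)
  · show (R - h + b) - b - ((R - h + b) + (R + h - b)) / 2 ≤ 0
    linarith

theorem locusX2_stdEllipse {a b : ℝ} (hb : 0 < b) (hab : b ≤ a)
    {S : EuclideanGeometry.Sphere Plane} (h : IsBrocardPair S (stdEllipse a b))
    (hc : S.center 1 ≤ 0) :
    locusX2 S (stdEllipse a b) =
      Metric.sphere !₂[0, -(√(4 * a ^ 4 - 5 * a ^ 2 * b ^ 2 + b ^ 4) / (3 * b))]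
        (2 * (a ^ 2 - b ^ 2) / (3 * b)) := by
  have ha : 0 < a := hb.trans_le hab
  obtain ⟨s, hs⟩ := h.exists_isStdPair hb hab
  have hR := hs.radius_pos
  have hs0 := hs.pos
  -- The radicand factors as `(4 a² - b²) (a² - b²)`, which is the square of `b * S.center 1`; the
  -- sign hypothesis selects the root.
  have hsqrt : √(4 * a ^ 4 - 5 * a ^ 2 * b ^ 2 + b ^ 4) = b * -S.center 1 := by
    rw [← Real.sqrt_sq (mul_nonneg hb.le (neg_nonneg.2 hc))]
    congr 1
    have h4 : a ^ 4 = (a ^ 2) ^ 2 := by ring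
    rw [mul_pow, neg_sq, hs.center_one_sq, h4, hs.a_sq, hs.b_eq]
    ring
  have hcen : -(b * -S.center 1 / (3 * b)) = S.center 1 / 3 := by
    field_simp
  have hrad : 2 * (a ^ 2 - b ^ 2) / (3 * b) = S.radius * (1 - 4 * s) / 3 := by
    rw [hs.a_sq, hs.b_eq]
    field_simp
    ring
  rw [hs.locusX2_eq ha hb, hsqrt, hcen, hrad]

theorem sphere_eq_setOf {a b : ℝ} (hb : 0 < b) (hab : b ≤ a) :
    Metric.sphere (!₂[0, -(√(4 * a ^ 4 - 5 * a ^ 2 * b ^ 2 + b ^ 4) / (3 * b))] : Plane)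
        (2 * (a ^ 2 - b ^ 2) / (3 * b)) =
      {p | p 0 ^ 2 + p 1 ^ 2 + 2 * √(4 * a ^ 4 - 5 * a ^ 2 * b ^ 2 + b ^ 4) / (3 * b) * p 1
        + 1 / 3 * (a ^ 2 - b ^ 2) = 0} := by
  have hsq := Real.sq_sqrt (discriminant_nonneg hb hab)
  have hr : 0 ≤ 2 * (a ^ 2 - b ^ 2) / (3 * b) := by
    have : 0 ≤ a ^ 2 - b ^ 2 := sub_nonneg.2 (pow_le_pow_left₀ hb.le hab 2)
    positivity
  ext p
  rw [mem_sphere_iff_sq hr]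
  have hb0 := hb.ne'
  generalize √(4 * a ^ 4 - 5 * a ^ 2 * b ^ 2 + b ^ 4) = q at hsq
  -- The constant term is `(4 a⁴ - 5 a² b² + b⁴ - 4 (a² - b²)²) / (9 b²) = (a² - b²) / 3`.
  have key : (p 0 - (!₂[0, -(q / (3 * b))] : Plane) 0) ^ 2
      + (p 1 - (!₂[0, -(q / (3 * b))] : Plane) 1) ^ 2 - (2 * (a ^ 2 - b ^ 2) / (3 * b)) ^ 2 =
      p 0 ^ 2 + p 1 ^ 2 + 2 * q / (3 * b) * p 1 + 1 / 3 * (a ^ 2 - b ^ 2) := by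
    simp
    field_simp
    linear_combination hsq
  rw [Set.mem_ofPred_eq, ← key, sub_eq_zero]

end BrocardPorism

theorem mainTheorem9 :
    (∀ (S : EuclideanGeometry.Sphere BrocardPorism.Plane) (E : Set BrocardPorism.Plane),
      BrocardPorism.IsBrocardPair S E →
      ∀ T ∈ BrocardPorism.family S E,
        (∃ ω : ℝ, BrocardPorism.IsBrocardAngle T ω) ∧
        ∀ ω : ℝ, BrocardPorism.IsBrocardAngle T ω →
          0 ≤ S.radius * (2 * Real.cos (2 * ω) - 1) / 3 ∧
          BrocardPorism.locusX2 S E =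
            Metric.sphere (BrocardPorism.X11171 T ω)
              (S.radius * (2 * Real.cos (2 * ω) - 1) / 3)) ∧
    (∀ a b : ℝ, 0 < b → b ≤ a →
      (∃ S : EuclideanGeometry.Sphere BrocardPorism.Plane,
        BrocardPorism.IsBrocardPair S (BrocardPorism.stdEllipse a b) ∧ S.center 1 ≤ 0) ∧
      ∀ S : EuclideanGeometry.Sphere BrocardPorism.Plane,
        BrocardPorism.IsBrocardPair S (BrocardPorism.stdEllipse a b) → S.center 1 ≤ 0 →
          BrocardPorism.locusX2 S (BrocardPorism.stdEllipse a b) =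
            Metric.sphere
              !₂[0, -(√(4 * a ^ 4 - 5 * a ^ 2 * b ^ 2 + b ^ 4) / (3 * b))]
              (2 * (a ^ 2 - b ^ 2) / (3 * b)) ∧
          BrocardPorism.locusX2 S (BrocardPorism.stdEllipse a b) =
            {p | p 0 ^ 2 + p 1 ^ 2
                + 2 * √(4 * a ^ 4 - 5 * a ^ 2 * b ^ 2 + b ^ 4) / (3 * b) * p 1
                + 1 / 3 * (a ^ 2 - b ^ 2) = 0}) := by
  refine ⟨fun S E h T hT => ⟨BrocardPorism.exists_isBrocardAngle T, fun ω hω =>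
    BrocardPorism.locusX2_eq_sphere h hT hω⟩, fun a b hb hab =>
    ⟨BrocardPorism.exists_isBrocardPair_stdEllipse hb hab, fun S hS hc => ⟨?_, ?_⟩⟩⟩
  · exact BrocardPorism.locusX2_stdEllipse hb hab hS hc
  · rw [BrocardPorism.locusX2_stdEllipse hb hab hS hc]
    exact BrocardPorism.sphere_eq_setOf hb hab
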